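/- Let $W$ be a complete discrete valuation ring with finite residue field of cardinality $q$, and let $\mathrm{val}$ be its valuation, normalized so that a uniformizer has valuation $1$ (and $\mathrm{val}(0)=+\infty$). Endow $W$ with its Haar probability measure, and let $d\ge 1$. The set $\Omega$ of pairs $(A,B)$ of monic polynomials of degree $d$ with coefficients in $W$ is identified with $W^{2d}$ through the non-leading coefficients, and is endowed with the product measure. For $0\le j<d$, the $j$-th principal subresultant $r_j(A,B)$ is the determinant, in the monomial bases ordered by decreasing degree, of the map $$W[X]_{<d-j}\times W[X]_{<d-j}\to W[X]_{<2d-j}/W[X]_{<j},\qquad (U,V)\mapsto AU+BV,$$ where $W[X]_{<n}$ is the module of polynomials of degree $<n$ (in the source, the basis of the first factor comes before that of the second). Let $V_j=\mathrm{val}(r_j(A,B))$, a random variable on $\Omega$ with values in $\mathbb N\cup\{+\infty\}$. Fix $j\in\{0,\dots,d-1\}$. Let $X_0,\dots,X_{d-1}$ be mutually independent random variables with values in $\mathbb N=\{0,1,2,\dots\}$, each with the geometric law of parameter $1-q^{-1}$, that is, $$\mathbb P[X_i=k]=(1-q^{-1})\,q^{-k}\qquad(0\le i<d,\ k\in\mathbb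 N),$$ and set $X_i=+\infty$ for $i<0$ and $X_i=0$ for $i\ge d$. Then $V_j$ has the same law as $$Y_j=\sum_{i=0}^{d}\min(X_{j-i},X_{j-i+1},\dots,X_{j+i}).$$ -/

import Mathlib

open Polynomial MeasureTheory ProbabilityTheory

/-- The matrix, in the canonical bases, of the truncated Sylvester map
`R[X]_{< dB - j} × R[X]_{< dA - j} → R[X]_{< dA + dB - j} / R[X]_{< j}`, `(U, V) ↦ A * U + B * V`.
The source basis is `(X^(dB-j-1), 0), …, (1, 0), (0, X^(dA-j-1)), …, (0, 1)` (the columns), the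
target basis is `X^(dA+dB-j-1), …, X^j` (the rows). It is meant for `j ≤ min dA dB`, with `dA` and
`dB` at least the degrees of `A` and `B`. -/
noncomputable def truncatedSylvester {R : Type*} [CommRing R] (A B : R[X]) (dA dB j : ℕ) :
    Matrix (Fin ((dB - j) + (dA - j))) (Fin ((dB - j) + (dA - j))) R :=
  Matrix.of fun r c => Fin.addCases
    (fun c₁ : Fin (dB - j) => (A * X ^ (dB - j - 1 - (c₁ : ℕ))).coeff (dA + dB - j - 1 - (r : ℕ)))
    (fun c₂ : Fin (dA - j) => (B * X ^ (dA - j - 1 - (c₂ : ℕ))).coeff (dA + dB - j - 1 - (r : ℕ)))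
    c

/-- The `j`-th principal subresultant of `A` and `B`, computed in degree `(dA, dB)`. -/
noncomputable def principalSubresultant {R : Type*} [CommRing R] (A B : R[X]) (dA dB j : ℕ) : R :=
  (truncatedSylvester A B dA dB j).det

/-- The monic polynomial `X^d + a_{d-1} X^(d-1) + ⋯ + a_0`; this is the canonical bijection
between `R^d` and the set of monic polynomials of degree `d`. -/
noncomputable def monicOfCoeffs {R : Type*} [CommRing R] {d : ℕ} (a : Fin d → R) : R[X] :=
  X ^ d + ∑ i : Fin d, C (a i) * X ^ (i : ℕ)

/-- `V_j`: the (normalized) valuation of the `j`-th principal subresultant of a pair of monic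
polynomials of degree `d`, the pair being given by its coefficients. -/
noncomputable def valPrincipalSubresultant {W : Type*} [CommRing W] [IsDomain W]
    [IsDiscreteValuationRing W] (d j : ℕ) (ω : (Fin d → W) × (Fin d → W)) : ℕ∞ :=
  IsDiscreteValuationRing.addVal W
    (principalSubresultant (monicOfCoeffs ω.1) (monicOfCoeffs ω.2) d d j)

/-- The extension of `x_0, …, x_{d-1}` to all integer indices by `x_i = +∞` for `i < 0` and
`x_i = 0` for `i ≥ d`. -/
noncomputable def extendIndex {d : ℕ} (x : Fin d → ℕ) (i : ℤ) : ℕ∞ :=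
  if i < 0 then ⊤ else if h : i.toNat < d then (x ⟨i.toNat, h⟩ : ℕ∞) else 0

/-- `Y_j = ∑_{i=0}^d min(x_{j-i}, x_{j-i+1}, …, x_{j+i})`, with the above convention for the
indices outside `{0, …, d-1}`. -/
noncomputable def sumOfMins {d : ℕ} (x : Fin d → ℕ) (j : ℕ) : ℕ∞ :=
  ∑ i ∈ Finset.range (d + 1), (Finset.Icc ((j : ℤ) - i) ((j : ℤ) + i)).inf (extendIndex x)

/-! Put n = d - j and C = B - A. Column operations on the truncated Sylvester matrix turn r_j, up to
a unit, into the Hankel determinant of size n of the expansion of C / A at infinity, and (A, C) is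
uniform when (A, B) is. Whether N ≤ V_j depends only on the pair modulo ϖ^N. So it suffices to
count, over the finite ring R = W / ϖ^N, where the class π of ϖ is nilpotent, the pairs whose Hankel
determinant is divisible by π^w, w ≤ N. Put t = 1/q.

Condition on the degree d - k of C modulo π (`HasStep`). A Euclidean step then lifts to R: A = Q A'
- V B' and C = E A' + U B' with U Q + E V = 1, Q monic of degree k and A' monic of degree d - k.
This parametrization (`euclidStep`) is injective because the first convergent E / Q is unique, and
surjective by counting; hence (Q, E) and (A', B') are independent and (A', B') is uniform. If k ≤ n,
the determinant is a unit times the one of size n - k of (A', B') (`hankelDet_step`). If n < k, it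
is the one of (Q, E) (`hankelDet_convergent`), associated by complementary minors to the one of size
r = k - n of (Q, V), where V inverts E modulo Q (`associated_hankelDet_of_inverse`). V is
distributed like E, and for k < 2n only coefficients that are multiples of π enter, so π^r factors
out. If the min(d, 2n - 1) top coefficients of C are all multiples of π, then π^n factors out. This
gives `hankelProb_recursion`.

On the geometric side, read X_{d-1}, X_{d-2}, … up to the first zero, at position k - 1. The windows
centred at position n - 1 that contain it contribute 0. If k ≤ n, the others see only the variables
after the zero: a sum of size n - k. If n < k < 2n, they see only the positive variables before it,
and memorylessness gives r plus a fresh sum of size r. With no zero among the first min(d, 2n - 1)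
variables, it is n plus a fresh sum of size n. The weights (1 - t) t^(k-1) are the same, so both
sides satisfy one recursion (`minSumProb_recursion`), whose solution is unique (`recursion_unique`).
-/

/-! ### Residues at infinity and Hankel determinants. -/

section Residue

variable {R : Type*} [CommRing R]

/-- The coefficient of `X⁻¹` in the expansion of `g / A` at infinity, for `A` monic. -/
noncomputable def residueAtInfinity (A : R[X]) : R[X] →ₗ[R] R :=
  (lcoeff R (A.natDegree - 1)) ∘ₗ (modByMonicHom A)

theorem residueAtInfinity_apply (A g : R[X]) :
    residueAtInfinity A g = (g %ₘ A).coeff (A.natDegree - 1) := rfl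

theorem residueAtInfinity_of_degree_lt [Nontrivial R] {A g : R[X]} (hA : A.Monic)
    (hg : g.degree < A.degree) : residueAtInfinity A g = g.coeff (A.natDegree - 1) := by
  rw [residueAtInfinity_apply, (modByMonic_eq_self_iff hA).2 hg]

theorem residueAtInfinity_mul_self {A : R[X]} (hA : A.Monic) (g : R[X]) :
    residueAtInfinity A (A * g) = 0 := by
  rw [residueAtInfinity_apply, self_mul_modByMonic hA, coeff_zero]

theorem residueAtInfinity_add_mul_self {A : R[X]} (hA : A.Monic) (f g : R[X]) :
    residueAtInfinity A (f + A * g) = residueAtInfinity A f := by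
  rw [map_add, residueAtInfinity_mul_self hA, add_zero]

theorem residueAtInfinity_eq_zero [Nontrivial R] {A g : R[X]} (hA : A.Monic) {m : ℕ}
    (hg : g.degree < (m : WithBot ℕ)) (hm : m + 1 ≤ A.natDegree) :
    residueAtInfinity A g = 0 := by
  rw [residueAtInfinity_of_degree_lt hA]
  · exact coeff_eq_zero_of_degree_lt (hg.trans_le (by exact_mod_cast (by omega)))
  · rw [degree_eq_natDegree hA.ne_zero]
    exact hg.trans_le (by exact_mod_cast (by omega))

/-- g / A = g B / (A B): residues with respect to different denominators become comparable. -/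
theorem residueAtInfinity_mul [Nontrivial R] {A B : R[X]} (hA : A.Monic) (hB : B.Monic)
    (hd : 1 ≤ A.natDegree) (g : R[X]) :
    residueAtInfinity (A * B) (g * B) = residueAtInfinity A g := by
  have hmod : (g * B) %ₘ (A * B) = (g %ₘ A) * B := by
    refine (div_modByMonic_unique (g /ₘ A) ((g %ₘ A) * B) (hA.mul hB) ⟨?_, ?_⟩).2
    · conv_rhs => rw [← modByMonic_add_div g A]
      ring
    · rw [hB.degree_mul, hB.degree_mul, degree_eq_natDegree hB.ne_zero]
      exact WithBot.add_lt_add_right (by simp) (degree_modByMonic_lt g hA)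
  rw [residueAtInfinity_apply, residueAtInfinity_apply, hmod, hA.natDegree_mul hB,
    show A.natDegree + B.natDegree - 1 = (A.natDegree - 1) + B.natDegree by omega,
    coeff_mul_add_eq_of_natDegree_le (df := A.natDegree - 1) (dg := B.natDegree) _ le_rfl,
    coeff_natDegree, hB.leadingCoeff, mul_one]
  have := natDegree_modByMonic_lt g hA (by rintro rfl; simp at hd)
  omega

/-- The determinant of the Hankel matrix of size `n` of the expansion of `B / A` at infinity. -/
noncomputable def hankelDet (n : ℕ) (A B : R[X]) : R :=
  (Matrix.of fun i j : Fin n => residueAtInfinity A (X ^ ((i : ℕ) + j) * B)).det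

theorem hankelDet_zero (A B : R[X]) : hankelDet 0 A B = 1 := Matrix.det_fin_zero

theorem hankelDet_congr {n : ℕ} {A B A' B' : R[X]}
    (h : ∀ m, m + 2 ≤ 2 * n →
      residueAtInfinity A (X ^ m * B) = residueAtInfinity A' (X ^ m * B')) :
    hankelDet n A B = hankelDet n A' B' := by
  unfold hankelDet
  congr 1
  ext i j
  exact h _ (by omega)

theorem hankelDet_smul {n : ℕ} {A B B' : R[X]} {r : R}
    (h : ∀ m, m + 2 ≤ 2 * n →
      residueAtInfinity A (X ^ m * B') = r * residueAtInfinity A (X ^ m * B)) :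
    hankelDet n A B' = r ^ n * hankelDet n A B := by
  have := Matrix.det_smul
    (Matrix.of fun i j : Fin n => residueAtInfinity A (X ^ ((i : ℕ) + j) * B)) r
  rw [Fintype.card_fin] at this
  unfold hankelDet
  rw [← this]
  congr 1
  ext i j
  exact h _ (by omega)

/-- The Hankel determinant computed in another basis of the polynomials of degree `< n`. -/
theorem det_gram_eq_hankelDet {n : ℕ} (A B : R[X]) (v : Fin n → R[X])
    (hv : ∀ i, (v i).Monic) (hd : ∀ i, (v i).natDegree = i) :
    (Matrix.of fun i j => residueAtInfinity A (v i * v j * B)).det = hankelDet n A B := by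
  set P : Matrix (Fin n) (Fin n) R := Matrix.of fun i l => (v i).coeff l with hP
  have hPdet : P.det = 1 := by
    rw [Matrix.det_of_isLowerTriangular]
    · refine Finset.prod_eq_one fun i _ => ?_
      have := (hv i).coeff_natDegree
      rwa [hd] at this
    · intro i j hij
      exact coeff_eq_zero_of_natDegree_lt (by rw [hd]; exact hij)
  have hsum : ∀ i, v i = ∑ l : Fin n, C (P i l) * X ^ (l : ℕ) := by
    intro i
    conv_lhs => rw [(v i).as_sum_range' n (by rw [hd]; exact i.2)]
    rw [← Fin.sum_univ_eq_sum_range (fun l => monomial l ((v i).coeff l)) n]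
    simp [hP, ← C_mul_X_pow_eq_monomial]
  have : (Matrix.of fun i j => residueAtInfinity A (v i * v j * B)) =
      P * (Matrix.of fun i j : Fin n => residueAtInfinity A (X ^ ((i : ℕ) + j) * B)) *
        P.transpose := by
    ext i j
    simp only [Matrix.mul_apply, Matrix.of_apply, Matrix.transpose_apply, Finset.sum_mul]
    have h1 : v i * v j * B = ∑ l' : Fin n, ∑ l : Fin n,
        (P i l * P j l') • (X ^ ((l : ℕ) + l') * B) := by
      conv_lhs => rw [hsum i, hsum j]
      rw [Finset.sum_mul_sum, Finset.sum_mul, Finset.sum_comm]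
      refine Finset.sum_congr rfl fun l _ => ?_
      rw [Finset.sum_mul]
      refine Finset.sum_congr rfl fun l' _ => ?_
      rw [smul_eq_C_mul, C_mul, pow_add]
      ring
    rw [h1, map_sum]
    refine Finset.sum_congr rfl fun l' _ => ?_
    rw [map_sum]
    refine Finset.sum_congr rfl fun l _ => ?_
    rw [map_smul, smul_eq_mul]
    ring
  rw [this, Matrix.det_mul, Matrix.det_mul, Matrix.det_transpose, hPdet, hankelDet]
  ring

end Residue

/-! ### Hankel determinants along one Euclidean step. -/

section ContinuedFraction

variable {R : Type*} [CommRing R]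

theorem degree_mul_lt_of_lt {f g : R[X]} {m n N : ℕ} (hf : f.degree < (m : WithBot ℕ))
    (hg : g.degree < (n : WithBot ℕ)) (hN : m + n ≤ N + 1) :
    (f * g).degree < (N : WithBot ℕ) := by
  rcases eq_or_ne f 0 with rfl | hf0
  · simp
  rcases eq_or_ne g 0 with rfl | hg0
  · simp
  refine lt_of_le_of_lt (degree_mul_le f g) ?_
  rw [degree_eq_natDegree hf0] at hf ⊢
  rw [degree_eq_natDegree hg0] at hg ⊢
  norm_cast at *
  omega

variable [Nontrivial R]

theorem degree_X_pow_mul_lt {g : R[X]} {a n N : ℕ} (hg : g.degree < (n : WithBot ℕ))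
    (hN : a + n ≤ N) : (X ^ a * g).degree < (N : WithBot ℕ) := by
  refine degree_mul_lt_of_lt (m := a + 1) ?_ hg (by omega)
  rw [degree_X_pow]
  exact_mod_cast Nat.lt_succ_self a

variable {k e : ℕ} {Q E U V A B A' B' : R[X]}

theorem degree_correction_lt (hQ : Q.Monic) (hQk : Q.natDegree = k) (hV : V.degree < (k : WithBot ℕ))
    (hA' : A'.Monic) (hA'e : A'.natDegree = e) (hB' : B'.degree < (e : WithBot ℕ)) :
    (-(V * B')).degree < (Q * A').degree := by
  rw [degree_neg, hA'.degree_mul, degree_eq_natDegree hQ.ne_zero, degree_eq_natDegree hA'.ne_zero,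
    hQk, hA'e]
  exact_mod_cast degree_mul_lt_of_lt hV hB' (by omega)

theorem monic_of_step (hQ : Q.Monic) (hQk : Q.natDegree = k) (hV : V.degree < (k : WithBot ℕ))
    (hA' : A'.Monic) (hA'e : A'.natDegree = e) (hB' : B'.degree < (e : WithBot ℕ))
    (hA : A = Q * A' - V * B') : A.Monic ∧ A.natDegree = k + e := by
  have h := degree_correction_lt hQ hQk hV hA' hA'e hB'
  rw [hA, sub_eq_add_neg]
  refine ⟨(hQ.mul hA').add_of_left h, ?_⟩
  rw [natDegree_add_eq_left_of_degree_lt h, hQ.natDegree_mul hA', hQk, hA'e]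

/-- Schur complement: the Hankel determinants after one step of the Euclidean algorithm. -/
theorem hankelDet_step {l : ℕ} (hQ : Q.Monic) (hQk : Q.natDegree = k)
    (hV : V.degree < (k : WithBot ℕ)) (hA' : A'.Monic) (hA'e : A'.natDegree = e)
    (hB' : B'.degree < (e : WithBot ℕ)) (hdet : U * Q + E * V = 1)
    (hA : A = Q * A' - V * B') (hB : B = E * A' + U * B') (hl : l ≤ e) :
    hankelDet (k + l) A B = hankelDet k A B * hankelDet l A' B' := by
  obtain ⟨hAm, hAd⟩ := monic_of_step hQ hQk hV hA' hA'e hB' hA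
  rcases Nat.eq_zero_or_pos l with rfl | hl0
  · rw [hankelDet_zero, mul_one, add_zero]
  set q : ℕ → R[X] := fun a => (X ^ a * B') /ₘ A' with hq
  set ρ : ℕ → R[X] := fun a => (X ^ a * B') %ₘ A' with hρ
  have hqρ : ∀ a, X ^ a * B' = ρ a + A' * q a := fun a => (modByMonic_add_div _ _).symm
  have hρd : ∀ a, (ρ a).degree < (e : WithBot ℕ) := fun a => by
    rw [← hA'e, ← degree_eq_natDegree hA'.ne_zero]
    exact degree_modByMonic_lt _ hA'
  -- Since Q B = E A + B' and A' = U A + V B, modulo A one has Q X^a B ≡ X^a B' and V q_a B ≡ A'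
  -- q_a. Their difference is ρ_a, so `v a * B` is congruent to a polynomial of degree < e.
  set v : ℕ → R[X] := fun a => Q * X ^ a - V * q a with hv
  have hvC : ∀ a, v a * B = ρ a + A * (X ^ a * E + q a * U) := fun a => by
    have h1 : ρ a = X ^ a * B' - A' * q a := by rw [hqρ]; ring
    rw [h1, hA, hB]
    linear_combination (X ^ a * B' - A' * q a) * hdet
  have hvA : ∀ a, v a * A' = X ^ a * A + V * ρ a := fun a => by
    have h1 : ρ a = X ^ a * B' - A' * q a := by rw [hqρ]; ring
    rw [h1, hA]
    ring
  have hqd : ∀ a, (q a).degree < ((a : ℕ) : WithBot ℕ) ∨ q a = 0 := fun a => by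
    by_cases h0 : q a = 0
    · exact Or.inr h0
    left
    have h1 : (A' * q a).degree < ((a + e : ℕ) : WithBot ℕ) := by
      rw [show A' * q a = X ^ a * B' - ρ a by rw [hqρ]; ring]
      refine (degree_sub_le _ _).trans_lt (max_lt ?_ ?_)
      · exact degree_X_pow_mul_lt hB' le_rfl
      · exact (hρd a).trans_le (by exact_mod_cast (by omega))
    rw [hA'.degree_mul_comm, hA'.degree_mul, degree_eq_natDegree hA'.ne_zero, hA'e,
      degree_eq_natDegree h0] at h1
    rw [degree_eq_natDegree h0]
    norm_cast at *
    omega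
  have hvm : ∀ a, (v a).Monic ∧ (v a).natDegree = k + a := fun a => by
    have hQX : (Q * X ^ a).Monic := hQ.mul (monic_X_pow a)
    have hQXd : (Q * X ^ a).natDegree = k + a := by
      rw [hQ.natDegree_mul (monic_X_pow a), natDegree_X_pow, hQk]
    have h1 : (-(V * q a)).degree < (Q * X ^ a).degree := by
      rw [degree_neg, degree_eq_natDegree hQX.ne_zero, hQXd]
      rcases hqd a with h | h
      · exact degree_mul_lt_of_lt hV h (by omega)
      · rw [h, mul_zero, degree_zero]; exact WithBot.bot_lt_coe _
    simp only [hv]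
    rw [sub_eq_add_neg]
    exact ⟨hQX.add_of_left h1, by rw [natDegree_add_eq_left_of_degree_lt h1, hQXd]⟩
  -- In the basis 1, …, X^(k-1), v_0, …, v_(l-1) the Gram matrix is block diagonal: X^i ρ_a with i <
  -- k has too low a degree to have a residue.
  set w : Fin (k + l) → R[X] := Fin.addCases (fun i => X ^ (i : ℕ)) (fun a => v a) with hw
  rw [← det_gram_eq_hankelDet A B w]
  rotate_left
  · intro i
    refine Fin.addCases (fun i => ?_) (fun i => ?_) i
    · simp [hw]
    · simpa [hw] using (hvm _).1
  · intro i
    refine Fin.addCases (fun i => ?_) (fun i => ?_) i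
    · simp [hw]
    · simpa [hw] using (hvm _).2
  have hlow : ∀ (i : Fin k) (a : ℕ), residueAtInfinity A (X ^ (i : ℕ) * v a * B) = 0 := by
    intro i a
    rw [mul_assoc, hvC, mul_add, mul_left_comm, residueAtInfinity_add_mul_self hAm]
    refine residueAtInfinity_eq_zero hAm (m := k - 1 + e) ?_ (by have := i.2; omega)
    exact degree_X_pow_mul_lt (hρd a) (by omega)
  have hhigh : ∀ a b : ℕ, residueAtInfinity A (v b * v a * B) =
      residueAtInfinity A' (X ^ (b + a) * B') := by
    intro a b
    have hA'1 : 1 ≤ A'.natDegree := by omega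
    rw [mul_assoc, hvC, mul_add, mul_left_comm (v b), residueAtInfinity_add_mul_self hAm,
      ← residueAtInfinity_mul hAm hA' (by omega), mul_right_comm, hvA,
      pow_add, mul_assoc (X ^ b), hqρ, mul_add, mul_left_comm (X ^ b),
      residueAtInfinity_add_mul_self hA', ← residueAtInfinity_mul hA' hAm (by omega),
      mul_comm A' A,
      show (X ^ b * A + V * ρ b) * ρ a = X ^ b * ρ a * A + V * (ρ b * ρ a) by ring, map_add]
    -- If nonzero, V ρ_b ρ_a has degree at most k + 2e - 3, while a polynomial of degree below deg
    -- (A A') has a residue only in degree k + 2e - 1.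
    rw [add_eq_left]
    refine residueAtInfinity_eq_zero (hAm.mul hA') (m := k + (e + e - 1) - 1) ?_ ?_
    · exact degree_mul_lt_of_lt hV (degree_mul_lt_of_lt (hρd b) (hρd a)
        (N := e + e - 1) (by omega)) (by omega)
    · rw [hAm.natDegree_mul hA']; omega
  rw [← Matrix.det_submatrix_equiv_self finSumFinEquiv]
  have hblock : (Matrix.of fun i j => residueAtInfinity A (w i * w j * B)).submatrix
      finSumFinEquiv finSumFinEquiv = Matrix.fromBlocks
        (Matrix.of fun i j : Fin k => residueAtInfinity A (X ^ ((i : ℕ) + j) * B)) 0 0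
        (Matrix.of fun i j : Fin l => residueAtInfinity A' (X ^ ((i : ℕ) + j) * B')) := by
    ext i j
    rcases i with i | i <;> rcases j with j | j
    · simp [hw, pow_add]
    · simpa [hw] using hlow i j
    · simpa [hw, mul_comm (v i)] using hlow j i
    · simpa [hw] using hhigh j i
  rw [hblock, Matrix.det_fromBlocks_zero₁₂]
  rfl

/-- The first Hankel determinants of the pair only depend on the first convergent. -/
theorem hankelDet_convergent {n : ℕ} (hQ : Q.Monic) (hQk : Q.natDegree = k)
    (hV : V.degree < (k : WithBot ℕ)) (hA' : A'.Monic) (hA'e : A'.natDegree = e)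
    (hB' : B'.degree < (e : WithBot ℕ)) (hdet : U * Q + E * V = 1)
    (hA : A = Q * A' - V * B') (hB : B = E * A' + U * B') (hn : n ≤ k) :
    hankelDet n A B = hankelDet n Q E := by
  obtain ⟨hAm, hAd⟩ := monic_of_step hQ hQk hV hA' hA'e hB' hA
  refine hankelDet_congr fun m hm => ?_
  -- So B / A - E / Q = B' / (A Q) has order at least 2k + 1 in 1 / X, whereas a Hankel determinant
  -- of size at most k sees at most the first 2k - 1 coefficients.
  have hQB : Q * B = A * E + B' := by
    rw [hA, hB]; linear_combination B' * hdet
  by_cases hk : k = 0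
  · subst hk
    have hn0 : n = 0 := by omega
    subst hn0
    omega
  rw [← residueAtInfinity_mul hAm hQ (by omega),
    ← residueAtInfinity_mul hQ hAm (by omega),
    show X ^ m * B * Q = X ^ m * E * A + X ^ m * B' by linear_combination X ^ m * hQB,
    mul_comm Q A, map_add, add_eq_left]
  refine residueAtInfinity_eq_zero (hAm.mul hQ) (m := m + e) ?_ ?_
  · exact degree_X_pow_mul_lt hB' le_rfl
  · rw [hAm.natDegree_mul hQ]; omega

end ContinuedFraction

/-! ### Complementary minors for inverses modulo a monic polynomial. -/

section Duality

variable {R : Type*} [CommRing R]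

theorem associated_det_submatrix {m n : Type*} [Fintype m] [DecidableEq m] [Fintype n]
    [DecidableEq n] (M : Matrix m m R) (e₁ e₂ : n ≃ m) :
    Associated (M.submatrix e₁ e₂).det M.det := by
  have h : M.submatrix e₁ e₂ = (M.submatrix (e₂.symm.trans e₁) id).submatrix e₂ e₂ := by
    ext i j; simp
  rw [h, Matrix.det_submatrix_equiv_self, Matrix.det_permute]
  refine associated_unit_mul_left _ _ ?_
  exact (Units.map (Int.castRingHom R).toMonoidHom (Equiv.Perm.sign (e₂.symm.trans e₁))).isUnit

theorem modByMonic_eq_sum {Q : R[X]} {k : ℕ} (hQ : Q.Monic) (hQk : Q.natDegree = k) (g : R[X]) :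
    g %ₘ Q = ∑ l : Fin k, C ((g %ₘ Q).coeff l) * X ^ (l : ℕ) := by
  rcases Nat.eq_zero_or_pos k with rfl | hk
  · rw [hQ.natDegree_eq_zero.1 hQk]
    simp
  have h := natDegree_modByMonic_lt g hQ (by rintro rfl; simp at hQk; omega)
  conv_lhs => rw [(g %ₘ Q).as_sum_range' k (by omega)]
  rw [← Fin.sum_univ_eq_sum_range (fun l => monomial l ((g %ₘ Q).coeff l)) k]
  simp [← C_mul_X_pow_eq_monomial]

theorem map_eq_sum_of_map_mul_eq_zero {M : Type*} [AddCommGroup M] [Module R M] {Q : R[X]} {k : ℕ}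
    (hQ : Q.Monic) (hQk : Q.natDegree = k) (φ : R[X] →ₗ[R] M) (hφ : ∀ g, φ (Q * g) = 0)
    (g : R[X]) : φ g = ∑ l : Fin k, (g %ₘ Q).coeff l • φ (X ^ (l : ℕ)) := by
  conv_lhs => rw [← modByMonic_add_div g Q, map_add, hφ, add_zero, modByMonic_eq_sum hQ hQk g,
    map_sum]
  simp [← smul_eq_C_mul]

variable [Nontrivial R]

theorem residueAtInfinity_X_pow_eq_zero {Q : R[X]} (hQ : Q.Monic) {m : ℕ}
    (hm : m + 1 < Q.natDegree) : residueAtInfinity Q (X ^ m) = 0 := by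
  refine residueAtInfinity_eq_zero hQ (m := m + 1) ?_ hm
  rw [degree_X_pow]
  exact_mod_cast Nat.lt_succ_self m

theorem residueAtInfinity_X_pow_eq_one {Q : R[X]} (hQ : Q.Monic) {m : ℕ}
    (hm : m + 1 = Q.natDegree) : residueAtInfinity Q (X ^ m) = 1 := by
  rw [residueAtInfinity_of_degree_lt hQ, ← hm, coeff_X_pow]
  · simp
  · rw [degree_X_pow, degree_eq_natDegree hQ.ne_zero, ← hm]
    exact_mod_cast Nat.lt_succ_self m

/-- The matrix is antitriangular with ones on the antidiagonal. -/
theorem isUnit_det_residueAtInfinity_X_pow {Q : R[X]} (hQ : Q.Monic) {n r : ℕ}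
    (hQk : Q.natDegree = n + r) :
    IsUnit (Matrix.of fun i j : Fin n =>
      residueAtInfinity Q (X ^ (r + (i : ℕ) + j))).det := by
  refine (associated_det_submatrix _ Fin.revPerm (Equiv.refl _)).isUnit ?_
  rw [Matrix.det_of_isUpperTriangular]
  · convert! isUnit_one
    refine Finset.prod_eq_one fun i _ => ?_
    simp only [Matrix.submatrix_apply, Matrix.of_apply, Fin.revPerm_apply, Fin.val_rev,
      Equiv.refl_apply]
    exact residueAtInfinity_X_pow_eq_one hQ (by omega)
  · intro i j hij
    simp only [Matrix.submatrix_apply, Matrix.of_apply, Fin.revPerm_apply, Fin.val_rev,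
      Equiv.refl_apply]
    have : (j : ℕ) < i := hij
    exact residueAtInfinity_X_pow_eq_zero hQ (by omega)

/-- Complementary minors: the Hankel determinants of two elements that are inverse to each other
modulo `Q`. -/
theorem associated_hankelDet_of_inverse {n r : ℕ} {Q E U V : R[X]} (hQ : Q.Monic)
    (hQk : Q.natDegree = n + r) (hdet : U * Q + E * V = 1) :
    Associated (hankelDet n Q E) (hankelDet r Q V) := by
  set τ := residueAtInfinity Q with hτ
  have hτQ : ∀ g, τ (Q * g) = 0 := residueAtInfinity_mul_self hQ
  -- Multiplication by V modulo Q has unit determinant and sends this family to 1, …, X^(n-1), V, …,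
  -- V X^(r-1). Paired with 1, …, X^(n+r-1), each of the two families gives, up to permutation, a
  -- block triangular matrix with one of the Hankel determinants on the diagonal and a unit beside
  -- it.
  set q : Fin n ⊕ Fin r → R[X] := Sum.elim (fun j => X ^ (j : ℕ) * E) (fun j => X ^ (j : ℕ))
    with hq
  set G : Matrix (Fin (n + r)) (Fin (n + r)) R := Matrix.of fun i l => τ (X ^ ((i : ℕ) + l))
  set P : Matrix (Fin (n + r)) (Fin (n + r)) R :=
    Matrix.of fun i c => (q (finSumFinEquiv.symm c) %ₘ Q).coeff i
  set M : R[X] → Matrix (Fin (n + r)) (Fin (n + r)) R :=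
    fun F => Matrix.of fun i l => ((F * X ^ (l : ℕ)) %ₘ Q).coeff i with hM
  set Z : R[X] → Matrix (Fin (n + r)) (Fin (n + r)) R :=
    fun F => Matrix.of fun i c => τ (X ^ (i : ℕ) * (F * q (finSumFinEquiv.symm c))) with hZ
  have hcoeff : ∀ (F g : R[X]) (i : ℕ), ((F * g) %ₘ Q).coeff i =
      ∑ l : Fin (n + r), ((F * X ^ (l : ℕ)) %ₘ Q).coeff i * (g %ₘ Q).coeff l := by
    intro F g i
    have := map_eq_sum_of_map_mul_eq_zero hQ hQk
      ((lcoeff R i) ∘ₗ (modByMonicHom Q) ∘ₗ (LinearMap.mulLeft R F)) (fun g => by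
        simp [mul_left_comm F, self_mul_modByMonic hQ]) g
    simpa [mul_comm] using this
  have hZM : ∀ F, Z F = G * M F * P := by
    intro F
    rw [Matrix.mul_assoc]
    ext i c
    have h1 : (M F * P) = Matrix.of fun i c =>
        ((F * q (finSumFinEquiv.symm c)) %ₘ Q).coeff (i : Fin (n + r)) := by
      ext i c
      rw [Matrix.mul_apply, Matrix.of_apply, hcoeff]
      rfl
    rw [h1, Matrix.mul_apply]
    have := map_eq_sum_of_map_mul_eq_zero hQ hQk (τ ∘ₗ (LinearMap.mulLeft R (X ^ (i : ℕ))))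
      (fun g => by simp [mul_left_comm _ Q, hτQ]) (F * q (finSumFinEquiv.symm c))
    simpa [hZ, mul_comm, pow_add, G] using this
  have hM1 : M 1 = 1 := by
    ext i l
    simp only [hM, Matrix.of_apply, one_mul, Matrix.one_apply]
    rw [(modByMonic_eq_self_iff hQ).2, coeff_X_pow]
    · simp only [Fin.ext_iff]
    rw [degree_X_pow, degree_eq_natDegree hQ.ne_zero, hQk]
    exact_mod_cast l.2
  have hMV : IsUnit (M V).det := by
    have h2 : M E * M V = 1 := by
      rw [← hM1]
      ext i l
      rw [Matrix.mul_apply, hM]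
      simp only [Matrix.of_apply]
      rw [← hcoeff, ← mul_assoc, show E * V = 1 - Q * U by linear_combination hdet, sub_mul,
        sub_modByMonic, mul_assoc, self_mul_modByMonic hQ, sub_zero]
    refine IsUnit.of_mul_eq_one (M E).det ?_
    rw [mul_comm, ← Matrix.det_mul, h2, Matrix.det_one]
  have hZ12 : Associated (Z 1).det (Z V).det := by
    rw [hZM, hZM, hM1, Matrix.mul_one, Matrix.det_mul, Matrix.det_mul, Matrix.det_mul]
    obtain ⟨u, hu⟩ := hMV
    exact ⟨u, by rw [← hu]; ring⟩
  have hZ1 : Associated (Z 1).det (hankelDet n Q E) := by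
    refine (associated_det_submatrix _ finSumFinEquiv finSumFinEquiv).symm.trans ?_
    have hblock : (Z 1).submatrix finSumFinEquiv finSumFinEquiv = Matrix.fromBlocks
        (Matrix.of fun i j : Fin n => residueAtInfinity Q (X ^ ((i : ℕ) + j) * E)) 0
        (Matrix.of fun (i : Fin r) (j : Fin n) => τ (X ^ (n + i : ℕ) * (X ^ (j : ℕ) * E)))
        (Matrix.of fun i j : Fin r => residueAtInfinity Q (X ^ (n + (i : ℕ) + j))) := by
      ext i j
      rcases i with i | i <;> rcases j with j | j
      · simp [hZ, hq, hτ, pow_add, mul_assoc]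
      · simp only [hZ, hq, Matrix.submatrix_apply, Matrix.of_apply, Equiv.symm_apply_apply,
          Sum.elim_inr, one_mul, Matrix.fromBlocks_apply₁₂, Matrix.zero_apply, ← pow_add]
        exact residueAtInfinity_X_pow_eq_zero hQ (by
          simp only [finSumFinEquiv_apply_left, Fin.val_castAdd]; omega)
      · simp [hZ, hq, hτ]
      · simp [hZ, hq, hτ, pow_add]
    rw [hblock, Matrix.det_fromBlocks_zero₁₂]
    exact associated_mul_unit_left _ _
      (isUnit_det_residueAtInfinity_X_pow hQ (by rw [hQk, add_comm]))
  have hZ2 : Associated (Z V).det (hankelDet r Q V) := by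
    -- Rows are split as r + n, and the columns V X^j are moved to the front.
    set e₁ : Fin r ⊕ Fin n ≃ Fin (n + r) :=
      finSumFinEquiv.trans (finCongr (add_comm r n)) with he₁
    set e₂ : Fin r ⊕ Fin n ≃ Fin (n + r) := (Equiv.sumComm _ _).trans finSumFinEquiv with he₂
    refine (associated_det_submatrix _ e₁ e₂).symm.trans ?_
    have hVE : ∀ i j : ℕ, τ (X ^ i * (V * (X ^ j * E))) = τ (X ^ (i + j)) := fun i j => by
      rw [show X ^ i * (V * (X ^ j * E)) = X ^ (i + j) + Q * (- X ^ (i + j) * U) by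
        rw [pow_add]; linear_combination X ^ i * X ^ j * hdet, map_add, hτQ, add_zero]
    have hblock : (Z V).submatrix e₁ e₂ = Matrix.fromBlocks
        (Matrix.of fun i j : Fin r => residueAtInfinity Q (X ^ ((i : ℕ) + j) * V)) 0
        (Matrix.of fun (i : Fin n) (j : Fin r) => τ (X ^ (r + i : ℕ) * (V * (X ^ (j : ℕ)))))
        (Matrix.of fun i j : Fin n => residueAtInfinity Q (X ^ (r + (i : ℕ) + j))) := by
      ext i j
      rcases i with i | i <;> rcases j with j | j
      · simp [hZ, hq, hτ, pow_add, mul_assoc, mul_comm V, he₁, he₂]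
      · simp only [hZ, hq, Matrix.submatrix_apply, Matrix.of_apply, he₁, he₂, Equiv.trans_apply,
          Equiv.symm_apply_apply, Equiv.sumComm_apply, Sum.swap_inr,
          Sum.elim_inl, hVE, Matrix.fromBlocks_apply₁₂, Matrix.zero_apply]
        exact residueAtInfinity_X_pow_eq_zero hQ (by simp; omega)
      · simp [hZ, hq, hτ, he₁, he₂, add_comm r]
      · simp only [hZ, hq, Matrix.submatrix_apply, Matrix.of_apply, he₁, he₂, Equiv.trans_apply,
          Equiv.symm_apply_apply, Equiv.sumComm_apply, Sum.swap_inr,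
          Sum.elim_inl, hVE, Matrix.fromBlocks_apply₂₂]
        simp [hτ, add_comm r]
    rw [hblock, Matrix.det_fromBlocks_zero₁₂]
    exact associated_mul_unit_left _ _ (isUnit_det_residueAtInfinity_X_pow hQ hQk)
  exact hZ1.symm.trans (hZ12.trans hZ2)

end Duality

/-! ### From subresultants to Hankel determinants. -/

section Subresultant

variable {R : Type*} [CommRing R] [Nontrivial R]

/-- The residues of X^i X^(d-1-r) form a unitriangular matrix; it converts the top coefficients of a
remainder into its residues against 1, X, …. -/
theorem associated_det_remainders_hankelDet {d n : ℕ} {A B : R[X]} (hA : A.Monic)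
    (hAd : A.natDegree = d) (hn : n ≤ d) :
    Associated (Matrix.of fun r c : Fin n =>
      ((X ^ (n - 1 - (c : ℕ)) * B) %ₘ A).coeff (d - 1 - r)).det (hankelDet n A B) := by
  refine (associated_det_submatrix _ (Equiv.refl _) Fin.revPerm).symm.trans ?_
  set L : Matrix (Fin n) (Fin n) R :=
    Matrix.of fun i r => residueAtInfinity A (X ^ ((i : ℕ) + (d - 1 - r))) with hL
  have hLdet : L.det = 1 := by
    rw [Matrix.det_of_isLowerTriangular]
    · exact Finset.prod_eq_one fun i _ => residueAtInfinity_X_pow_eq_one hA (by omega)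
    · intro i j hij
      have : (i : ℕ) < j := hij
      exact residueAtInfinity_X_pow_eq_zero hA (by omega)
  have hH : (Matrix.of fun i j : Fin n => residueAtInfinity A (X ^ ((i : ℕ) + j) * B)) =
      L * (Matrix.of fun r c : Fin n => ((X ^ (n - 1 - (c : ℕ)) * B) %ₘ A).coeff
        (d - 1 - r)).submatrix (Equiv.refl _) Fin.revPerm := by
    ext i b
    rw [Matrix.mul_apply, Matrix.of_apply]
    simp only [hL, Matrix.submatrix_apply, Matrix.of_apply, Equiv.refl_apply, Fin.revPerm_apply,
      Fin.val_rev]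
    rw [show n - 1 - (n - ((b : ℕ) + 1)) = b by omega]
    have h1 := map_eq_sum_of_map_mul_eq_zero hA hAd
      (residueAtInfinity A ∘ₗ (LinearMap.mulLeft R (X ^ (i : ℕ))))
      (fun g => by simp [mul_left_comm _ A, residueAtInfinity_mul_self hA]) (X ^ (b : ℕ) * B)
    simp only [LinearMap.comp_apply, LinearMap.mulLeft_apply, ← pow_add, smul_eq_mul] at h1
    rw [pow_add, mul_assoc, h1, Fin.sum_univ_eq_sum_range
      (fun l => ((X ^ (b : ℕ) * B) %ₘ A).coeff l * residueAtInfinity A (X ^ ((i : ℕ) + l))) d,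
      Fin.sum_univ_eq_sum_range (fun r => residueAtInfinity A (X ^ ((i : ℕ) + (d - 1 - r))) *
        ((X ^ (b : ℕ) * B) %ₘ A).coeff (d - 1 - r)) n, ← Finset.sum_range_reflect]
    symm
    refine (Finset.sum_subset (Finset.range_mono hn) ?_).trans ?_
    · intro r hr hr'
      rw [Finset.mem_range] at hr hr'
      rw [residueAtInfinity_X_pow_eq_zero hA (by omega), zero_mul]
    · exact Finset.sum_congr rfl fun r _ => mul_comm _ _
  rw [hankelDet, hH, Matrix.det_mul, hLdet, one_mul]

/-- X^b B = A g_b + ρ_b, where ρ_b is the remainder of X^b (B - A) and deg g_b < n. Subtracting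
combinations of the columns of A replaces those of B by the ρ_b, which vanish in the rows of degree
at least d; the corresponding block of A is unitriangular. -/
theorem associated_principalSubresultant_hankelDet {d j : ℕ} {A B : R[X]} (hA : A.Monic)
    (hAd : A.natDegree = d) (hB : (B - A).degree < (d : WithBot ℕ)) (hj : j ≤ d) :
    Associated (principalSubresultant A B d d j) (hankelDet (d - j) A (B - A)) := by
  have hAdeg : A.degree = (d : WithBot ℕ) := by rw [degree_eq_natDegree hA.ne_zero, hAd]
  set n := d - j with hn
  set ρ : ℕ → R[X] := fun b => (X ^ b * (B - A)) %ₘ A with hρ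
  set g : ℕ → R[X] := fun b => X ^ b + (X ^ b * (B - A)) /ₘ A with hg
  have hBg : ∀ b, B * X ^ b = A * g b + ρ b := fun b => by
    have := modByMonic_add_div (X ^ b * (B - A)) A
    simp only [hg, hρ]
    linear_combination -this
  have hρd : ∀ b, (ρ b).degree < (d : WithBot ℕ) := fun b => by
    rw [← hAdeg]
    exact degree_modByMonic_lt _ hA
  have hgd : ∀ b < n, (g b).natDegree < n := by
    intro b hb
    refine (natDegree_add_le _ _).trans_lt (max_lt ((natDegree_X_pow_le b).trans_lt hb) ?_)
    rw [natDegree_divByMonic _ hA, hAd]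
    rcases eq_or_ne (X ^ b * (B - A)) 0 with h0 | h0
    · rw [h0]; simp; omega
    have := degree_X_pow_mul_lt (a := b) hB le_rfl
    rw [degree_eq_natDegree h0] at this
    norm_cast at this
    omega
  have hgs : ∀ b < n, g b = ∑ c : Fin n, C ((g b).coeff (n - 1 - c)) * X ^ (n - 1 - (c : ℕ)) := by
    intro b hb
    rw [Fin.sum_univ_eq_sum_range
      (fun c => C ((g b).coeff (n - 1 - c)) * X ^ (n - 1 - (c : ℕ))) n,
      Finset.sum_range_reflect (fun l => C ((g b).coeff l) * X ^ l)]
    exact (g b).as_sum_range_C_mul_X_pow' (hgd b hb)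
  set N : Matrix (Fin n) (Fin n) R :=
    Matrix.of fun c' c => (g (n - 1 - c)).coeff (n - 1 - c') with hN
  set S₁ : Matrix (Fin n) (Fin n) R :=
    Matrix.of fun r c => (A * X ^ (n - 1 - (c : ℕ))).coeff (d + d - j - 1 - r) with hS₁
  set S₂ : Matrix (Fin n) (Fin n) R :=
    Matrix.of fun r c => (A * X ^ (n - 1 - (c : ℕ))).coeff (d - 1 - r) with hS₂
  set M : Matrix (Fin n) (Fin n) R :=
    Matrix.of fun r c => (ρ (n - 1 - (c : ℕ))).coeff (d - 1 - r) with hM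
  have hcol : ∀ (c : Fin n) (D : ℕ), (B * X ^ (n - 1 - (c : ℕ))).coeff D =
      ∑ c' : Fin n, (A * X ^ (n - 1 - (c' : ℕ))).coeff D * N c' c +
        (ρ (n - 1 - (c : ℕ))).coeff D := by
    intro c D
    rw [hBg, coeff_add]
    conv_lhs => rw [hgs (n - 1 - c) (by omega)]
    rw [Finset.mul_sum, finsetSum_coeff]
    congr 1
    refine Finset.sum_congr rfl fun c' _ => ?_
    rw [mul_left_comm, coeff_C_mul, mul_comm]
    rfl
  have hS : (truncatedSylvester A B d d j).submatrix finSumFinEquiv finSumFinEquiv =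
      Matrix.fromBlocks S₁ 0 S₂ M * Matrix.fromBlocks 1 N 0 1 := by
    rw [Matrix.fromBlocks_multiply]
    simp only [Matrix.mul_one, Matrix.mul_zero, add_zero]
    ext i c
    rcases i with i | i <;> rcases c with c | c
    · simp [truncatedSylvester, hS₁, hn]
    · simp only [truncatedSylvester, Matrix.submatrix_apply, finSumFinEquiv_apply_left,
        finSumFinEquiv_apply_right, Matrix.of_apply, Fin.addCases_right, Fin.val_castAdd,
        Matrix.fromBlocks_apply₁₂, Matrix.mul_apply, hS₁]
      rw [hcol]
      rw [add_eq_left]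
      exact coeff_eq_zero_of_degree_lt ((hρd _).trans_le (by exact_mod_cast (by omega)))
    · simp only [truncatedSylvester, Matrix.submatrix_apply, finSumFinEquiv_apply_left,
        finSumFinEquiv_apply_right, Matrix.of_apply, Fin.addCases_left, Fin.val_natAdd,
        Matrix.fromBlocks_apply₂₁, hS₂]
      rw [show d + d - j - 1 - (d - j + (i : ℕ)) = d - 1 - i by omega]
    · simp only [truncatedSylvester, Matrix.submatrix_apply,
        finSumFinEquiv_apply_right, Matrix.of_apply, Fin.addCases_right, Fin.val_natAdd,
        Matrix.fromBlocks_apply₂₂, Matrix.add_apply, Matrix.mul_apply, hS₂, hM]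
      rw [show d + d - j - 1 - (d - j + (i : ℕ)) = d - 1 - i by omega, hcol]
  have hS₁det : S₁.det = 1 := by
    rw [Matrix.det_of_isLowerTriangular]
    · refine Finset.prod_eq_one fun i _ => ?_
      simp only [hS₁, Matrix.of_apply]
      rw [show d + d - j - 1 - (i : ℕ) = d + (n - 1 - i) by omega, coeff_mul_X_pow, ← hAd,
        coeff_natDegree, hA.leadingCoeff]
    · intro i c hic
      have : (i : ℕ) < c := hic
      simp only [hS₁, Matrix.of_apply]
      rw [show d + d - j - 1 - (i : ℕ) = d + (c - i) + (n - 1 - c) by omega, coeff_mul_X_pow]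
      exact coeff_eq_zero_of_natDegree_lt (by omega)
  have hdet : principalSubresultant A B d d j = M.det := by
    rw [principalSubresultant, ← Matrix.det_submatrix_equiv_self finSumFinEquiv, hS,
      Matrix.det_mul, Matrix.det_fromBlocks_zero₁₂, Matrix.det_fromBlocks_zero₂₁, hS₁det]
    simp
  rw [hdet]
  exact associated_det_remainders_hankelDet hA hAd (by omega)

end Subresultant

/-! ### Polynomials and their coefficient vectors. -/

section Coefficients

variable {R : Type*} [CommRing R]

/-- The polynomial of degree `< d` with given coefficients. -/
noncomputable def lowPoly {d : ℕ} (c : Fin d → R) : R[X] := ∑ i : Fin d, C (c i) * X ^ (i : ℕ)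

theorem monicOfCoeffs_eq_add_lowPoly {d : ℕ} (a : Fin d → R) :
    monicOfCoeffs a = X ^ d + lowPoly a := rfl

theorem coeff_lowPoly {d : ℕ} (c : Fin d → R) (i : Fin d) : (lowPoly c).coeff i = c i := by
  simp [lowPoly, finsetSum_coeff, coeff_X_pow, ← Fin.ext_iff]

theorem degree_lowPoly_lt {d : ℕ} (c : Fin d → R) : (lowPoly c).degree < (d : WithBot ℕ) :=
  degree_sum_fin_lt c

theorem lowPoly_coeff {d : ℕ} {P : R[X]} (hP : P.degree < (d : WithBot ℕ)) :
    lowPoly (fun i : Fin d => P.coeff i) = P := by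
  rcases eq_or_ne P 0 with rfl | h0
  · simp [lowPoly]
  rw [lowPoly, Fin.sum_univ_eq_sum_range (fun i => C (P.coeff i) * X ^ i) d]
  rw [degree_eq_natDegree h0] at hP
  exact (P.as_sum_range_C_mul_X_pow' (by exact_mod_cast hP)).symm

theorem lowPoly_injective {d : ℕ} : Function.Injective (lowPoly : (Fin d → R) → R[X]) := by
  intro c c' h
  ext i
  rw [← coeff_lowPoly c, h, coeff_lowPoly]

theorem monicOfCoeffs_injective {d : ℕ} :
    Function.Injective (monicOfCoeffs : (Fin d → R) → R[X]) := by
  intro a a' h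
  exact lowPoly_injective (add_left_cancel h)

theorem monicOfCoeffs_coeff [Nontrivial R] {d : ℕ} {A : R[X]} (hA : A.Monic)
    (hAd : A.natDegree = d) : monicOfCoeffs (fun i : Fin d => A.coeff i) = A := by
  rw [monicOfCoeffs, Fin.sum_univ_eq_sum_range (fun i => C (A.coeff i) * X ^ i) d, ← hAd]
  exact hA.as_sum.symm

theorem monic_monicOfCoeffs {d : ℕ} (a : Fin d → R) : (monicOfCoeffs a).Monic :=
  monic_X_pow_add (degree_lowPoly_lt a)

theorem natDegree_monicOfCoeffs [Nontrivial R] {d : ℕ} (a : Fin d → R) : (monicOfCoeffs a).natDegree = d := by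
  rw [monicOfCoeffs_eq_add_lowPoly, natDegree_add_eq_left_of_degree_lt, natDegree_X_pow]
  rw [degree_X_pow]
  exact degree_lowPoly_lt a

end Coefficients

/-! ### The lifted Euclidean step: uniqueness and Bézout coefficients. -/

section Step

variable {R : Type*} [CommRing R]

/-- The first convergent of a pair of polynomials is determined by the pair. -/
theorem convergent_unique [Nontrivial R] {k e : ℕ} {Q Q₂ E E₂ U V A B A' B' B₂' : R[X]} (hQ : Q.Monic)
    (hQk : Q.natDegree = k) (hQ₂ : Q₂.Monic) (hQ₂k : Q₂.natDegree = k)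
    (hV : V.degree < (k : WithBot ℕ)) (hA' : A'.Monic)
    (hA'e : A'.natDegree = e) (hB' : B'.degree < (e : WithBot ℕ))
    (hB₂' : B₂'.degree < (e : WithBot ℕ)) (hdet : U * Q + E * V = 1)
    (hA : A = Q * A' - V * B') (hB : B = E * A' + U * B') (h₂ : Q₂ * B - E₂ * A = B₂') :
    Q = Q₂ ∧ E = E₂ := by
  set p := Q - Q₂ with hp
  set f := E - E₂ with hf
  -- (g, h) is obtained from (p, f) by a unimodular change of coordinates, and A' g + B' h has
  -- degree < e. If g ≠ 0, cancelling A' g forces deg h > deg g. So if h ≠ 0, then Q h dominates V g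
  -- in p = V g + Q h, against deg p < k. Hence h = 0, and then g = 0.
  set g := p * E - f * Q with hg
  set h := p * U + f * V with hh
  have hρ : A' * g + B' * h = B' - B₂' := by
    rw [← h₂, hg, hh, hp, hf, hA, hB]
    linear_combination B' * hdet
  have hpgh : p = V * g + Q * h := by
    rw [hg, hh]; linear_combination (-p) * hdet
  have hfgh : f = -U * g + E * h := by
    rw [hg, hh]; linear_combination (-f) * hdet
  have hpd : p.degree < (k : WithBot ℕ) := by
    rw [hp, ← hQk, ← degree_eq_natDegree hQ.ne_zero]
    refine degree_sub_lt_left ?_ hQ.ne_zero (by rw [hQ.leadingCoeff, hQ₂.leadingCoeff])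
    rw [degree_eq_natDegree hQ.ne_zero, degree_eq_natDegree hQ₂.ne_zero, hQk, hQ₂k]
  have hρd : (B' - B₂').degree < (e : WithBot ℕ) :=
    (degree_sub_le _ _).trans_lt (max_lt hB' hB₂')
  have hgh : g ≠ 0 → h ≠ 0 ∧ g.natDegree < h.natDegree := by
    intro hg0
    by_contra hcon
    have h1 : (B' * h).degree < ((e + g.natDegree : ℕ) : WithBot ℕ) := by
      rcases eq_or_ne h 0 with h0 | h0
      · rw [h0, mul_zero, degree_zero]; exact WithBot.bot_lt_coe _
      · refine degree_mul_lt_of_lt hB' (n := g.natDegree + 1) ?_ (by omega)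
        rw [degree_eq_natDegree h0]
        have : h.natDegree ≤ g.natDegree := by
          by_contra h2
          exact hcon ⟨h0, by omega⟩
        exact_mod_cast Nat.lt_succ_of_le this
    have h2 : (A' * g).degree = ((e + g.natDegree : ℕ) : WithBot ℕ) := by
      rw [hA'.degree_mul_comm, hA'.degree_mul, degree_eq_natDegree hg0,
        degree_eq_natDegree hA'.ne_zero, hA'e, add_comm e]
      rfl
    have h3 : (A' * g + B' * h).degree = ((e + g.natDegree : ℕ) : WithBot ℕ) := by
      rw [degree_add_eq_left_of_degree_lt (by rw [h2]; exact h1), h2]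
    rw [hρ] at h3
    rw [h3] at hρd
    norm_cast at hρd
    omega
  have hh0 : h = 0 := by
    by_contra hh0
    have h1 : (Q * h).degree = ((k + h.natDegree : ℕ) : WithBot ℕ) := by
      rw [hQ.degree_mul_comm, hQ.degree_mul, degree_eq_natDegree hh0,
        degree_eq_natDegree hQ.ne_zero, hQk, add_comm k]
      rfl
    have h2 : (V * g).degree < ((k + h.natDegree : ℕ) : WithBot ℕ) := by
      rcases eq_or_ne g 0 with h0 | h0
      · rw [h0, mul_zero, degree_zero]; exact WithBot.bot_lt_coe _
      · refine degree_mul_lt_of_lt hV (n := h.natDegree) ?_ (by omega)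
        rw [degree_eq_natDegree h0]
        exact_mod_cast (hgh h0).2
    rw [hpgh, degree_add_eq_right_of_degree_lt (by rw [h1]; exact h2), h1] at hpd
    norm_cast at hpd
    omega
  have hg0 : g = 0 := by
    by_contra hg0
    exact (hgh hg0).1 hh0
  rw [hg0, hh0, mul_zero, mul_zero, add_zero] at hpgh hfgh
  exact ⟨sub_eq_zero.1 hpgh, sub_eq_zero.1 hfgh⟩

/-- The coefficients of index larger than `d - k` are divisible by `π`, and the one of index
`d - k` is a unit. -/
def HasStep (π : R) (k : ℕ) {d : ℕ} (c : Fin d → R) : Prop :=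
  (∀ i : Fin d, d < (i : ℕ) + k → π ∣ c i) ∧ ∀ i : Fin d, (i : ℕ) + k = d → IsUnit (c i)

/-- The inverse of `E` modulo `Q`, for `E` a unit. -/
noncomputable def inverseMod (Q E : R[X]) : R[X] := Ring.inverse E %ₘ Q

/-- The Bézout coefficient of `Q` in the relation given by `inverseMod`. -/
noncomputable def bezoutCoeff (Q E : R[X]) : R[X] := E * (Ring.inverse E /ₘ Q)

theorem bezoutCoeff_mul_add {Q E : R[X]} (hE : IsUnit E) :
    bezoutCoeff Q E * Q + E * inverseMod Q E = 1 := by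
  have h1 := modByMonic_add_div (Ring.inverse E) Q
  have h2 := Ring.mul_inverse_cancel E hE
  rw [bezoutCoeff, inverseMod]
  linear_combination E * h1 + h2

theorem degree_inverseMod_lt [Nontrivial R] {Q : R[X]} {k : ℕ} (hQ : Q.Monic)
    (hQk : Q.natDegree = k) (E : R[X]) :
    (inverseMod Q E).degree < (k : WithBot ℕ) := by
  rw [← hQk, ← degree_eq_natDegree hQ.ne_zero]
  exact degree_modByMonic_lt _ hQ

/-- U Q = 1 - E V has degree < 2k and Q is monic of degree k. -/
theorem degree_bezoutCoeff_lt [Nontrivial R] {Q E : R[X]} {k : ℕ} (hk : 0 < k) (hQ : Q.Monic)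
    (hQk : Q.natDegree = k) (hE : IsUnit E) (hEk : E.degree < (k : WithBot ℕ)) :
    (bezoutCoeff Q E).degree < (k : WithBot ℕ) := by
  rcases eq_or_ne (bezoutCoeff Q E) 0 with h0 | h0
  · rw [h0, degree_zero]; exact WithBot.bot_lt_coe _
  have h1 : (bezoutCoeff Q E * Q).degree < ((k + k : ℕ) : WithBot ℕ) := by
    rw [eq_sub_of_add_eq (bezoutCoeff_mul_add hE)]
    refine (degree_sub_le _ _).trans_lt (max_lt ?_ ?_)
    · rw [degree_one]; exact_mod_cast (by omega)
    · exact degree_mul_lt_of_lt hEk (degree_inverseMod_lt hQ hQk E) (by omega)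
  rw [hQ.degree_mul, degree_eq_natDegree h0, degree_eq_natDegree hQ.ne_zero, hQk] at h1
  rw [degree_eq_natDegree h0]
  norm_cast at *
  omega

theorem C_dvd_modByMonic {π : R} {F Q : R[X]} (h : C π ∣ F) : C π ∣ F %ₘ Q := by
  obtain ⟨G, rfl⟩ := h
  rw [← smul_eq_C_mul, smul_modByMonic, smul_eq_C_mul]
  exact dvd_mul_right _ _

theorem C_dvd_of_dvd_mul_monic [Nontrivial R] {π : R} {F Q : R[X]} (hQ : Q.Monic) (h : C π ∣ F * Q) :
    C π ∣ F := by
  obtain ⟨G, hG⟩ := h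
  refine ⟨G /ₘ Q, ?_⟩
  have h1 : (F * Q) /ₘ Q = C π * (G /ₘ Q) := by
    refine (div_modByMonic_unique _ (C π * (G %ₘ Q)) hQ ⟨?_, ?_⟩).1
    · rw [hG]
      linear_combination C π * modByMonic_add_div G Q
    · rw [← smul_eq_C_mul]
      exact (degree_smul_le _ _).trans_lt (degree_modByMonic_lt G hQ)
  rw [← h1, mul_comm, mul_divByMonic_cancel_left _ hQ]

variable {π : R}

/-- When the length is k itself, the unit coefficient is the constant one. Thus E is a unit constant
modulo π, hence a unit of R[X] as soon as π is nilpotent. -/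
theorem exists_eq_C_add_of_hasStep {k : ℕ} (hk : 0 < k) {c : Fin k → R} (hc : HasStep π k c) :
    ∃ u : Rˣ, C π ∣ lowPoly c - C (u : R) := by
  obtain ⟨u, hu⟩ := hc.2 ⟨0, hk⟩ (by simp)
  refine ⟨u, ?_⟩
  rw [C_dvd_iff_dvd_coeff]
  intro i
  rw [coeff_sub, coeff_C]
  by_cases hi : i < k
  · have h1 := coeff_lowPoly c ⟨i, hi⟩
    simp only at h1
    rw [h1]
    split_ifs with h0
    · subst h0
      simp [hu]
    · rw [sub_zero]
      exact hc.1 _ (by simp only; omega)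
  · rw [coeff_eq_zero_of_degree_lt ((degree_lowPoly_lt c).trans_le (by exact_mod_cast (by omega))),
      if_neg (by omega), sub_zero]
    exact dvd_zero _

theorem isUnit_of_C_dvd_sub_C (hnil : IsNilpotent π) {E : R[X]} {u : Rˣ}
    (h : C π ∣ E - C (u : R)) : IsUnit E := by
  obtain ⟨G, hG⟩ := h
  rw [sub_eq_iff_eq_add.1 hG]
  have h1 : IsNilpotent (C π * G) :=
    (Commute.all _ _).isNilpotent_mul_right (hnil.map C)
  exact h1.isUnit_add_right_of_commute (u.isUnit.map C) (Commute.all _ _)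

end Step

/-! ### Counting pairs through the Euclidean step and duality. -/

section Counting

variable {R : Type*} [CommRing R]

/-- The pair of polynomials with given first convergent and given remainders. -/
noncomputable def euclidStep {k e : ℕ} (z : ((Fin k → R) × (Fin k → R)) ×
    ((Fin e → R) × (Fin e → R))) : (Fin (e + k) → R) × (Fin (e + k) → R) :=
  (fun i => (monicOfCoeffs z.1.1 * monicOfCoeffs z.2.1 -
      inverseMod (monicOfCoeffs z.1.1) (lowPoly z.1.2) * lowPoly z.2.2).coeff i,
    fun i => (lowPoly z.1.2 * monicOfCoeffs z.2.1 +
      bezoutCoeff (monicOfCoeffs z.1.1) (lowPoly z.1.2) * lowPoly z.2.2).coeff i)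

variable {π : R} {k e : ℕ}

theorem isUnit_lowPoly (hnil : IsNilpotent π) (hk : 0 < k) {c : Fin k → R} (hc : HasStep π k c) :
    IsUnit (lowPoly c) := by
  obtain ⟨u, hu⟩ := exists_eq_C_add_of_hasStep hk hc
  exact isUnit_of_C_dvd_sub_C hnil hu

theorem hasStep_of_C_dvd {c : Fin k → R} {u : Rˣ} (hu : C π ∣ lowPoly c - C (u : R))
    (hnil : IsNilpotent π) : HasStep π k c := by
  rw [C_dvd_iff_dvd_coeff] at hu
  refine ⟨fun i hi => ?_, fun i hi => ?_⟩
  · have := hu i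
    rwa [coeff_sub, coeff_lowPoly, coeff_C, if_neg (by omega), sub_zero] at this
  · have := hu i
    rw [coeff_sub, coeff_lowPoly, coeff_C, if_pos (by omega)] at this
    obtain ⟨x, hx⟩ := this
    rw [sub_eq_iff_eq_add.1 hx]
    exact ((Commute.all _ _).isNilpotent_mul_right hnil).isUnit_add_right_of_commute u.isUnit
      (Commute.all _ _)

theorem ncard_hasStep :
    {c : Fin (e + k) → R | HasStep π k c}.ncard =
      {c : Fin k → R | HasStep π k c}.ncard * Nat.card R ^ e := by
  have h : {c : Fin (e + k) → R | HasStep π k c} = (Fin.appendEquiv e k) ''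
      ((Set.univ : Set (Fin e → R)) ×ˢ {c : Fin k → R | HasStep π k c}) := by
    ext c
    obtain ⟨⟨c₁, c₂⟩, rfl⟩ := (Fin.appendEquiv e k).surjective c
    rw [(Fin.appendEquiv e k).injective.mem_set_image]
    simp only [Set.mem_ofPred_eq, Set.mem_prod, Set.mem_univ, true_and, HasStep,
      Fin.forall_fin_add, Fin.appendEquiv_apply, Fin.append_left, Fin.append_right,
      Fin.val_castAdd, Fin.val_natAdd]
    constructor
    · rintro ⟨⟨-, h1⟩, -, h2⟩
      exact ⟨fun i hi => h1 i (by omega), fun i hi => h2 i (by omega)⟩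
    · rintro ⟨h1, h2⟩
      exact ⟨⟨fun i hi => by omega, fun i hi => h1 i (by omega)⟩,
        fun i hi => by omega, fun i hi => h2 i (by omega)⟩
  rw [h, Set.ncard_image_of_injective _ (Fin.appendEquiv e k).injective, Set.ncard_prod,
    Set.ncard_univ, Nat.card_fun, Nat.card_fin, mul_comm]

variable [Nontrivial R]

theorem monicOfCoeffs_euclidStep (z : ((Fin k → R) × (Fin k → R)) × ((Fin e → R) × (Fin e → R))) :
    monicOfCoeffs (euclidStep z).1 = monicOfCoeffs z.1.1 * monicOfCoeffs z.2.1 -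
      inverseMod (monicOfCoeffs z.1.1) (lowPoly z.1.2) * lowPoly z.2.2 := by
  have h := monic_of_step (monic_monicOfCoeffs z.1.1) (natDegree_monicOfCoeffs z.1.1)
    (degree_inverseMod_lt (monic_monicOfCoeffs z.1.1) (natDegree_monicOfCoeffs z.1.1)
      (lowPoly z.1.2)) (monic_monicOfCoeffs z.2.1) (natDegree_monicOfCoeffs z.2.1)
    (degree_lowPoly_lt z.2.2) rfl
  have h2 := h.2
  rw [add_comm k e] at h2
  exact monicOfCoeffs_coeff h.1 h2

theorem lowPoly_euclidStep (hnil : IsNilpotent π) (hk : 0 < k)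
    {z : ((Fin k → R) × (Fin k → R)) × ((Fin e → R) × (Fin e → R))} (hz : HasStep π k z.1.2) :
    lowPoly (euclidStep z).2 = lowPoly z.1.2 * monicOfCoeffs z.2.1 +
      bezoutCoeff (monicOfCoeffs z.1.1) (lowPoly z.1.2) * lowPoly z.2.2 := by
  have hA' : (monicOfCoeffs z.2.1).degree < ((e + 1 : ℕ) : WithBot ℕ) := by
    rw [degree_eq_natDegree (monic_monicOfCoeffs z.2.1).ne_zero, natDegree_monicOfCoeffs]
    exact_mod_cast Nat.lt_succ_self e
  refine lowPoly_coeff ((degree_add_le _ _).trans_lt (max_lt ?_ ?_))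
  · exact degree_mul_lt_of_lt (degree_lowPoly_lt _) hA' (by omega)
  · exact degree_mul_lt_of_lt (degree_bezoutCoeff_lt hk (monic_monicOfCoeffs _)
      (natDegree_monicOfCoeffs _) (isUnit_lowPoly hnil hk hz) (degree_lowPoly_lt _))
      (degree_lowPoly_lt _) (by omega)

theorem C_dvd_inverseMod_sub {Q E : R[X]} {u : Rˣ} (hk : 0 < k) (hQ : Q.Monic)
    (hQk : Q.natDegree = k) (hE : IsUnit E) (hu : C π ∣ E - C (u : R)) :
    C π ∣ inverseMod Q E - C ((u⁻¹ : Rˣ) : R) := by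
  have h1 : C ((u⁻¹ : Rˣ) : R) %ₘ Q = C ((u⁻¹ : Rˣ) : R) := by
    rw [modByMonic_eq_self_iff hQ, degree_eq_natDegree hQ.ne_zero, hQk]
    exact degree_C_le.trans_lt (by exact_mod_cast hk)
  rw [inverseMod, ← h1, ← sub_modByMonic]
  refine C_dvd_modByMonic ?_
  have h2 := Ring.mul_inverse_cancel E hE
  have h3 : C (u : R) * C ((u⁻¹ : Rˣ) : R) = 1 := by rw [← C_mul]; simp
  rw [show Ring.inverse E - C ((u⁻¹ : Rˣ) : R) =
    (E - C (u : R)) * (-(C ((u⁻¹ : Rˣ) : R) * Ring.inverse E)) by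
      linear_combination (C ((u⁻¹ : Rˣ) : R)) * h2 - (Ring.inverse E) * h3]
  exact hu.mul_right _

theorem C_dvd_bezoutCoeff {Q E : R[X]} {u : Rˣ} (hk : 0 < k) (hQ : Q.Monic)
    (hQk : Q.natDegree = k) (hE : IsUnit E) (hu : C π ∣ E - C (u : R)) :
    C π ∣ bezoutCoeff Q E := by
  refine C_dvd_of_dvd_mul_monic hQ ?_
  rw [eq_sub_of_add_eq (bezoutCoeff_mul_add hE)]
  have h3 : C (u : R) * C ((u⁻¹ : Rˣ) : R) = 1 := by rw [← C_mul]; simp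
  rw [show 1 - E * inverseMod Q E = (E - C (u : R)) * (-inverseMod Q E) +
    (inverseMod Q E - C ((u⁻¹ : Rˣ) : R)) * (- C (u : R)) by linear_combination - h3]
  exact dvd_add (hu.mul_right _) ((C_dvd_inverseMod_sub hk hQ hQk hE hu).mul_right _)

/-- Modulo π, E ≡ u and U ≡ 0, so E A' + U B' ≡ u A', which has degree e and leading coefficient u.
-/
theorem hasStep_euclidStep (hnil : IsNilpotent π) (hk : 0 < k)
    {z : ((Fin k → R) × (Fin k → R)) × ((Fin e → R) × (Fin e → R))} (hz : HasStep π k z.1.2) :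
    HasStep π k (euclidStep z).2 := by
  obtain ⟨u, hu⟩ := exists_eq_C_add_of_hasStep hk hz
  have hU := C_dvd_bezoutCoeff hk (monic_monicOfCoeffs z.1.1) (natDegree_monicOfCoeffs z.1.1)
    (isUnit_lowPoly hnil hk hz) hu
  have h : C π ∣ lowPoly (euclidStep z).2 - C (u : R) * monicOfCoeffs z.2.1 := by
    rw [lowPoly_euclidStep hnil hk hz, add_sub_right_comm, ← sub_mul]
    exact dvd_add (hu.mul_right _) (hU.mul_right _)
  rw [C_dvd_iff_dvd_coeff] at h
  have hA' := natDegree_monicOfCoeffs z.2.1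
  refine ⟨fun i hi => ?_, fun i hi => ?_⟩
  · have := h i
    rwa [coeff_sub, coeff_lowPoly, coeff_C_mul, coeff_eq_zero_of_natDegree_lt (by omega),
      mul_zero, sub_zero] at this
  · have := h i
    have h1 : (monicOfCoeffs z.2.1).coeff i = 1 := by
      rw [show (i : ℕ) = (monicOfCoeffs z.2.1).natDegree by omega]
      exact monic_monicOfCoeffs z.2.1
    rw [coeff_sub, coeff_lowPoly, coeff_C_mul, h1, mul_one] at this
    obtain ⟨x, hx⟩ := this
    rw [sub_eq_iff_eq_add.1 hx]
    exact ((Commute.all _ _).isNilpotent_mul_right hnil).isUnit_add_right_of_commute u.isUnit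
      (Commute.all _ _)

/-- Q and E are recovered as the first convergent; they determine U and V, and the matrix of
determinant 1 can be inverted. -/
theorem injOn_euclidStep (hnil : IsNilpotent π) (hk : 0 < k) :
    Set.InjOn (euclidStep : ((Fin k → R) × (Fin k → R)) × ((Fin e → R) × (Fin e → R)) → _)
      {z | HasStep π k z.1.2} := by
  rintro z hz y hy hzy
  have hA : monicOfCoeffs (euclidStep z).1 = monicOfCoeffs (euclidStep y).1 := by rw [hzy]
  have hB : lowPoly (euclidStep z).2 = lowPoly (euclidStep y).2 := by rw [hzy]
  rw [monicOfCoeffs_euclidStep, monicOfCoeffs_euclidStep] at hA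
  rw [lowPoly_euclidStep hnil hk hz, lowPoly_euclidStep hnil hk hy] at hB
  have hdz := bezoutCoeff_mul_add (Q := monicOfCoeffs z.1.1) (isUnit_lowPoly hnil hk hz)
  have hdy := bezoutCoeff_mul_add (Q := monicOfCoeffs y.1.1) (isUnit_lowPoly hnil hk hy)
  obtain ⟨hQ, hE⟩ := convergent_unique (monic_monicOfCoeffs z.1.1)
    (natDegree_monicOfCoeffs z.1.1)
    (monic_monicOfCoeffs y.1.1) (natDegree_monicOfCoeffs y.1.1)
    (degree_inverseMod_lt (monic_monicOfCoeffs z.1.1) (natDegree_monicOfCoeffs z.1.1)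
      (lowPoly z.1.2)) (monic_monicOfCoeffs z.2.1) (natDegree_monicOfCoeffs z.2.1)
    (degree_lowPoly_lt z.2.2) (degree_lowPoly_lt y.2.2) hdz rfl rfl
    (E₂ := lowPoly y.1.2) (by rw [hA, hB]; linear_combination lowPoly y.2.2 * hdy)
  rw [← hQ, ← hE] at hA hB
  have h1 : monicOfCoeffs z.2.1 = monicOfCoeffs y.2.1 := by
    linear_combination (bezoutCoeff (monicOfCoeffs z.1.1) (lowPoly z.1.2)) * hA +
      (inverseMod (monicOfCoeffs z.1.1) (lowPoly z.1.2)) * hB +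
      (monicOfCoeffs y.2.1 - monicOfCoeffs z.2.1) * hdz
  have h2 : lowPoly z.2.2 = lowPoly y.2.2 := by
    linear_combination (-lowPoly z.1.2) * hA + (monicOfCoeffs z.1.1) * hB +
      (lowPoly y.2.2 - lowPoly z.2.2) * hdz
  exact Prod.ext (Prod.ext (monicOfCoeffs_injective hQ) (lowPoly_injective hE))
    (Prod.ext (monicOfCoeffs_injective h1) (lowPoly_injective h2))

variable [Finite R]

/-- Surjectivity by cardinality: both sets have |R|^(k+2e) times as many elements as there are
admissible E. -/
theorem image_euclidStep (hnil : IsNilpotent π) (hk : 0 < k) :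
    (euclidStep : ((Fin k → R) × (Fin k → R)) × ((Fin e → R) × (Fin e → R)) → _) ''
      {z | HasStep π k z.1.2} = {y | HasStep π k y.2} := by
  refine Set.eq_of_subset_of_ncard_le ?_ ?_ (Set.toFinite _)
  · rintro _ ⟨z, hz, rfl⟩
    exact hasStep_euclidStep hnil hk hz
  · rw [(injOn_euclidStep hnil hk).ncard_image]
    have h1 : {y : (Fin (e + k) → R) × (Fin (e + k) → R) | HasStep π k y.2} =
        Set.univ ×ˢ {c | HasStep π k c} := by ext; simp
    have h2 : {z : ((Fin k → R) × (Fin k → R)) × ((Fin e → R) × (Fin e → R)) |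
        HasStep π k z.1.2} = (Set.univ ×ˢ {c | HasStep π k c}) ×ˢ Set.univ := by ext; simp
    rw [h1, h2, Set.ncard_prod, Set.ncard_prod, Set.ncard_prod, ncard_hasStep, Set.ncard_univ,
      Set.ncard_univ, Set.ncard_univ, Nat.card_prod, Nat.card_fun, Nat.card_fun, Nat.card_fun]
    simp only [Nat.card_fin]
    rw [pow_add]
    exact le_of_eq (by ring)

theorem ncard_hasStep_and (hnil : IsNilpotent π) (hk : 0 < k)
    {p : (Fin (e + k) → R) × (Fin (e + k) → R) → Prop}
    {p' : ((Fin k → R) × (Fin k → R)) × ((Fin e → R) × (Fin e → R)) → Prop}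
    (hp : ∀ z, HasStep π k z.1.2 → (p (euclidStep z) ↔ p' z)) :
    {y | HasStep π k y.2 ∧ p y}.ncard = {z | HasStep π k z.1.2 ∧ p' z}.ncard := by
  have h : {y | HasStep π k y.2 ∧ p y} = euclidStep '' {z | HasStep π k z.1.2 ∧ p' z} := by
    ext y
    constructor
    · rintro ⟨h1, h2⟩
      have : y ∈ {y : (Fin (e + k) → R) × (Fin (e + k) → R) | HasStep π k y.2} := h1
      rw [← image_euclidStep hnil hk] at this
      obtain ⟨z, hz, rfl⟩ := this
      exact ⟨z, ⟨hz, (hp z hz).1 h2⟩, rfl⟩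
    · rintro ⟨z, ⟨hz, hz'⟩, rfl⟩
      exact ⟨hasStep_euclidStep hnil hk hz, (hp z hz).2 hz'⟩
  rw [h, ((injOn_euclidStep hnil hk).mono fun z hz => hz.1).ncard_image]

/-- The Hankel determinant of a pair of polynomials given by their coefficients. -/
noncomputable def hankelDetOfCoeffs (n : ℕ) {d : ℕ} (y : (Fin d → R) × (Fin d → R)) : R :=
  hankelDet n (monicOfCoeffs y.1) (lowPoly y.2)

theorem ncard_hasStep_dvd_of_le (hnil : IsNilpotent π) (hk : 0 < k) {l : ℕ} (hl : l ≤ e) (b : R) :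
    {y : (Fin (e + k) → R) × (Fin (e + k) → R) |
      HasStep π k y.2 ∧ b ∣ hankelDetOfCoeffs (k + l) y}.ncard =
    {x : (Fin k → R) × (Fin k → R) | HasStep π k x.2}.ncard *
      {y : (Fin e → R) × (Fin e → R) | b ∣ hankelDetOfCoeffs l y}.ncard := by
  rw [← Set.ncard_prod, ncard_hasStep_and hnil hk (p' := fun z => b ∣ hankelDetOfCoeffs l z.2)]
  · rfl
  intro z hz
  have hE := isUnit_lowPoly hnil hk hz
  have hQ := monic_monicOfCoeffs z.1.1
  have hQk := natDegree_monicOfCoeffs z.1.1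
  have hA' := monic_monicOfCoeffs z.2.1
  have hA'e := natDegree_monicOfCoeffs z.2.1
  have hV := degree_inverseMod_lt hQ hQk (lowPoly z.1.2)
  have hdet := bezoutCoeff_mul_add (Q := monicOfCoeffs z.1.1) hE
  have hB' := degree_lowPoly_lt z.2.2
  have hA := monicOfCoeffs_euclidStep z
  have hB := lowPoly_euclidStep hnil hk hz
  -- The factor of size k is a unit because it is dual to the empty determinant.
  have hu : IsUnit (hankelDet k (monicOfCoeffs (euclidStep z).1) (lowPoly (euclidStep z).2)) := by
    rw [hankelDet_convergent hQ hQk hV hA' hA'e hB' hdet hA hB le_rfl]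
    refine (associated_hankelDet_of_inverse (r := 0) hQ hQk hdet).symm.isUnit ?_
    rw [hankelDet_zero]
    exact isUnit_one
  rw [hankelDetOfCoeffs, hankelDet_step hQ hQk hV hA' hA'e hB' hdet hA hB hl]
  exact hu.dvd_mul_left

theorem ncard_hasStep_dvd_of_ge (hnil : IsNilpotent π) (hk : 0 < k) {n : ℕ} (hn : n ≤ k) (b : R) :
    {y : (Fin (e + k) → R) × (Fin (e + k) → R) |
      HasStep π k y.2 ∧ b ∣ hankelDetOfCoeffs n y}.ncard =
    {x : (Fin k → R) × (Fin k → R) | HasStep π k x.2 ∧ b ∣ hankelDetOfCoeffs n x}.ncard *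
      (Nat.card R ^ e * Nat.card R ^ e) := by
  rw [show Nat.card R ^ e * Nat.card R ^ e =
    (Set.univ : Set ((Fin e → R) × (Fin e → R))).ncard by
      rw [Set.ncard_univ, Nat.card_prod, Nat.card_fun, Nat.card_fin], ← Set.ncard_prod,
    ncard_hasStep_and hnil hk (p' := fun z => b ∣ hankelDetOfCoeffs n z.1)]
  · congr 1
    ext z
    simp
  intro z hz
  have hQ := monic_monicOfCoeffs z.1.1
  have hQk := natDegree_monicOfCoeffs z.1.1
  rw [hankelDetOfCoeffs, hankelDet_convergent hQ hQk (degree_inverseMod_lt hQ hQk (lowPoly z.1.2))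
    (monic_monicOfCoeffs z.2.1) (natDegree_monicOfCoeffs z.2.1) (degree_lowPoly_lt z.2.2)
    (bezoutCoeff_mul_add (Q := monicOfCoeffs z.1.1) (isUnit_lowPoly hnil hk hz))
    (monicOfCoeffs_euclidStep z) (lowPoly_euclidStep hnil hk hz) hn]
  rfl

/-- Duality: inversion of the numerator modulo the denominator. -/
theorem ncard_hasStep_dvd_dual (hnil : IsNilpotent π) (hk : 0 < k) {n r : ℕ} (hnr : n + r = k)
    (b : R) :
    {x : (Fin k → R) × (Fin k → R) | HasStep π k x.2 ∧ b ∣ hankelDetOfCoeffs n x}.ncard =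
    {x : (Fin k → R) × (Fin k → R) | HasStep π k x.2 ∧ b ∣ hankelDetOfCoeffs r x}.ncard := by
  -- `F` replaces E by its inverse V modulo Q. It preserves `HasStep` since V ≡ u⁻¹ modulo π, and V
  -- determines E modulo Q, so `F` permutes a finite set.
  set F : (Fin k → R) × (Fin k → R) → (Fin k → R) × (Fin k → R) := fun x =>
    (x.1, fun i => (inverseMod (monicOfCoeffs x.1) (lowPoly x.2)).coeff i) with hF
  have hFlow : ∀ x, lowPoly (F x).2 = inverseMod (monicOfCoeffs x.1) (lowPoly x.2) := fun x =>
    lowPoly_coeff (degree_inverseMod_lt (monic_monicOfCoeffs _) (natDegree_monicOfCoeffs _) _)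
  have hmaps : ∀ x, HasStep π k x.2 → HasStep π k (F x).2 := by
    intro x hx
    obtain ⟨u, hu⟩ := exists_eq_C_add_of_hasStep hk hx
    refine hasStep_of_C_dvd (u := u⁻¹) ?_ hnil
    rw [hFlow]
    exact C_dvd_inverseMod_sub hk (monic_monicOfCoeffs _) (natDegree_monicOfCoeffs _)
      (isUnit_lowPoly hnil hk hx) hu
  have hinj : Set.InjOn F {x | HasStep π k x.2} := by
    rintro x hx y hy hxy
    have h1 : x.1 = y.1 := (Prod.ext_iff.1 hxy).1
    have h2 : lowPoly (F x).2 = lowPoly (F y).2 := by rw [hxy]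
    rw [hFlow, hFlow, ← h1] at h2
    have hdx := bezoutCoeff_mul_add (Q := monicOfCoeffs x.1) (isUnit_lowPoly hnil hk hx)
    have hdy := bezoutCoeff_mul_add (Q := monicOfCoeffs x.1) (isUnit_lowPoly hnil hk hy)
    have hQ := monic_monicOfCoeffs x.1
    have hdeg : ∀ c : Fin k → R, lowPoly c %ₘ monicOfCoeffs x.1 = lowPoly c := fun c => by
      rw [modByMonic_eq_self_iff hQ, degree_eq_natDegree hQ.ne_zero, natDegree_monicOfCoeffs]
      exact degree_lowPoly_lt c
    refine Prod.ext h1 (lowPoly_injective ?_)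
    rw [← hdeg x.2, ← hdeg y.2, ← sub_eq_zero, ← sub_modByMonic]
    set U₁ := bezoutCoeff (monicOfCoeffs x.1) (lowPoly x.2)
    set U₂ := bezoutCoeff (monicOfCoeffs x.1) (lowPoly y.2)
    rw [show lowPoly x.2 - lowPoly y.2 = monicOfCoeffs x.1 *
      (U₂ * lowPoly x.2 - U₁ * lowPoly y.2) by
        linear_combination lowPoly y.2 * hdx - lowPoly x.2 * hdy -
          lowPoly x.2 * lowPoly y.2 * h2]
    exact self_mul_modByMonic hQ
  have himage : F '' {x | HasStep π k x.2} = {x | HasStep π k x.2} := by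
    refine Set.eq_of_subset_of_ncard_le ?_ (by rw [hinj.ncard_image]) (Set.toFinite _)
    rintro _ ⟨x, hx, rfl⟩
    exact hmaps x hx
  have hdvd : ∀ x, HasStep π k x.2 →
      (b ∣ hankelDetOfCoeffs n x ↔ b ∣ hankelDetOfCoeffs r (F x)) := by
    intro x hx
    refine Associated.dvd_iff_dvd_right ?_
    rw [hankelDetOfCoeffs, hankelDetOfCoeffs, hFlow]
    exact associated_hankelDet_of_inverse (monic_monicOfCoeffs x.1)
      (by rw [natDegree_monicOfCoeffs, hnr])
      (bezoutCoeff_mul_add (isUnit_lowPoly hnil hk hx))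
  have h : {x : (Fin k → R) × (Fin k → R) | HasStep π k x.2 ∧ b ∣ hankelDetOfCoeffs r x} =
      F '' {x | HasStep π k x.2 ∧ b ∣ hankelDetOfCoeffs n x} := by
    ext y
    constructor
    · rintro ⟨h1, h2⟩
      have : y ∈ {x : (Fin k → R) × (Fin k → R) | HasStep π k x.2} := h1
      rw [← himage] at this
      obtain ⟨z, hz, rfl⟩ := this
      exact ⟨z, ⟨hz, (hdvd z hz).2 h2⟩, rfl⟩
    · rintro ⟨z, ⟨hz, hz'⟩, rfl⟩
      exact ⟨hmaps z hz, (hdvd z hz).1 hz'⟩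
  rw [h, (hinj.mono fun z hz => hz.1).ncard_image]

end Counting

/-! ### Uniform laws on finite groups and products. -/

section Fibers

theorem ncard_comp_mul_ncard_range {G : Type*} [AddCommGroup G] [Finite G] (f : G →+ G)
    (p : G → Prop) :
    {g | p (f g)}.ncard * (Set.range f).ncard =
      {h | h ∈ Set.range f ∧ p h}.ncard * Nat.card G := by
  classical
  have := Fintype.ofFinite G
  have key : ∀ S : Set G, S ⊆ Set.range f →
      {g | f g ∈ S}.ncard = S.ncard * (Finset.univ.filter fun g => f g = 0).card := by
    intro S hS
    rw [Set.ncard_eq_toFinset_card', Set.ncard_eq_toFinset_card',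
      Finset.card_eq_sum_card_fiberwise (f := f) (t := S.toFinset)]
    · rw [← smul_eq_mul]
      refine Finset.sum_eq_card_nsmul fun y hy => ?_
      rw [Set.mem_toFinset] at hy
      rw [← AddMonoidHom.card_fiber_eq_of_mem_range f (hS hy) (y := 0) ⟨0, map_zero f⟩]
      congr 1
      ext g
      simp only [Finset.mem_filter, Set.mem_toFinset, Set.mem_ofPred_eq, Finset.mem_univ, true_and]
      exact ⟨fun h => h.2, fun h => ⟨h ▸ hy, h⟩⟩
    · intro g hg
      simpa using hg
  have h1 := key _ subset_rfl
  have h2 := key {h | h ∈ Set.range f ∧ p h} fun h hh => hh.1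
  have h3 : {g | f g ∈ Set.range f} = Set.univ := Set.eq_univ_of_forall fun g => ⟨g, rfl⟩
  have h4 : {g | f g ∈ {h | h ∈ Set.range f ∧ p h}} = {g | p (f g)} := by ext g; simp
  rw [h3, Set.ncard_univ] at h1
  rw [h4] at h2
  rw [h2, h1]
  ring

/-- A condition on one coordinate is independent of the other coordinates. -/
theorem ncard_coord_and {α R : Type*} [Finite α] [Finite R] {d : ℕ} (i : Fin d) (Z : R → Prop)
    (p : α × (Fin d → R) → Prop)
    (hp : ∀ a c s, p (a, Function.update c i s) ↔ p (a, c)) :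
    {y : α × (Fin d → R) | Z (y.2 i) ∧ p y}.ncard * Nat.card R =
      {s | Z s}.ncard * {y : α × (Fin d → R) | p y}.ncard := by
  classical
  -- This involution exchanges the coordinate i with an independent copy of it.
  set F : (α × (Fin d → R)) × R → (α × (Fin d → R)) × R :=
    fun x => ((x.1.1, Function.update x.1.2 i x.2), x.1.2 i) with hF
  have hFF : Function.Involutive F := by
    rintro ⟨⟨a, c⟩, s⟩
    simp [hF]
  have h : {y : α × (Fin d → R) | p y} ×ˢ {s : R | Z s} =
      F '' ({y : α × (Fin d → R) | Z (y.2 i) ∧ p y} ×ˢ Set.univ) := by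
    rw [Set.image_eq_preimage_of_inverse hFF.leftInverse hFF.rightInverse]
    ext ⟨⟨a, c⟩, s⟩
    simp [hF, hp, and_comm]
  rw [mul_comm {s | Z s}.ncard, ← Set.ncard_prod, h, Set.ncard_image_of_injective _ hFF.injective,
    Set.ncard_prod, Set.ncard_univ]

end Fibers

/-! ### Conditioning on divisibility of the top coefficients. -/

section Scaling

variable {R : Type*} [CommRing R]

/-- The coefficients of the `m` largest indices are divisible by `π`. -/
def TopDvd (π : R) (m : ℕ) {d : ℕ} (c : Fin d → R) : Prop := ∀ i : Fin d, d ≤ (i : ℕ) + m → π ∣ c i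

/-- Multiplication by `π` of the coefficients of the `m` largest indices. -/
def scaleTop (π : R) (m d : ℕ) : (Fin d → R) →+ (Fin d → R) where
  toFun c i := if d ≤ (i : ℕ) + m then π * c i else c i
  map_zero' := by ext i; simp
  map_add' c c' := by ext i; simp only [Pi.add_apply]; split_ifs <;> ring

theorem scaleTop_apply (π : R) (m d : ℕ) (c : Fin d → R) (i : Fin d) :
    scaleTop π m d c i = if d ≤ (i : ℕ) + m then π * c i else c i := rfl

theorem mem_range_scaleTop {π : R} {m d : ℕ} {c : Fin d → R} :
    c ∈ Set.range (scaleTop π m d) ↔ TopDvd π m c := by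
  constructor
  · rintro ⟨c, rfl⟩ i hi
    rw [scaleTop_apply, if_pos hi]
    exact dvd_mul_right _ _
  · intro h
    choose f hf using h
    refine ⟨fun i => if h : d ≤ (i : ℕ) + m then f i h else c i, ?_⟩
    ext i
    rw [scaleTop_apply]
    split_ifs with h
    · rw [← hf i h]
    · rfl

theorem hasStep_iff {π : R} {m d : ℕ} {c : Fin d → R} :
    HasStep π (m + 1) c ↔ TopDvd π m c ∧ ∀ i : Fin d, (i : ℕ) + (m + 1) = d → IsUnit (c i) := by
  refine and_congr_left fun _ => forall_congr' fun i => ?_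
  rw [← add_assoc, Nat.lt_succ_iff]

theorem topDvd_succ_iff {π : R} {m d : ℕ} {c : Fin d → R} :
    TopDvd π (m + 1) c ↔ TopDvd π m c ∧ ∀ i : Fin d, (i : ℕ) + (m + 1) = d → π ∣ c i := by
  constructor
  · exact fun h => ⟨fun i hi => h i (by omega), fun i hi => h i (by omega)⟩
  · rintro ⟨h1, h2⟩ i hi
    by_cases h : d ≤ (i : ℕ) + m
    · exact h1 i h
    · exact h2 i (by omega)

theorem ncard_topDvd (π : R) {m d : ℕ} (hm : m ≤ d) :
    {c : Fin d → R | TopDvd π m c}.ncard = {x | π ∣ x}.ncard ^ m * Nat.card R ^ (d - m) := by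
  classical
  have h : {c : Fin d → R | TopDvd π m c} = Set.univ.pi fun i : Fin d =>
      if d ≤ (i : ℕ) + m then {x | π ∣ x} else Set.univ := by
    ext c
    simp only [TopDvd, Set.mem_ofPred_eq, Set.mem_pi, Set.mem_univ, true_implies]
    refine forall_congr' fun i => ?_
    split_ifs with hi <;> simp [hi]
  rw [h, ← Nat.card_coe_set_eq, Nat.card_congr (Equiv.Set.univPi _), Nat.card_pi]
  have h2 : ∀ i : Fin d, Nat.card ↥(if d ≤ (i : ℕ) + m then {x | π ∣ x} else Set.univ) =
      if d - m ≤ (i : ℕ) then {x | π ∣ x}.ncard else Nat.card R := by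
    intro i
    by_cases hi : d ≤ (i : ℕ) + m
    · rw [if_pos hi, if_pos (by omega)]; rfl
    · rw [if_neg hi, if_neg (by omega), Nat.card_univ]
  rw [Finset.prod_congr rfl fun i _ => h2 i,
    Fin.prod_univ_eq_prod_range (fun i => if d - m ≤ i then {x | π ∣ x}.ncard else Nat.card R) d,
    Finset.prod_ite, Finset.prod_const, Finset.prod_const]
  congr 2
  · have : (Finset.range d).filter (fun i => d - m ≤ i) = Finset.Ico (d - m) d := by
      ext i; simp; omega
    rw [this, Nat.card_Ico]; omega
  · have : (Finset.range d).filter (fun i => ¬ d - m ≤ i) = Finset.range (d - m) := by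
      ext i; simp; omega
    rw [this, Finset.card_range]

variable [Finite R]

/-- The proportion of the elements satisfying a predicate. -/
noncomputable def proportion {α : Type*} (p : α → Prop) : ℝ := ({a | p a}.ncard : ℝ) / Nat.card α

theorem card_pos_real : (0 : ℝ) < Nat.card R := by exact_mod_cast Nat.card_pos

/-- Scaling is additive, so it carries the uniform law to the uniform law on its range, which is the
set of vectors satisfying `TopDvd`. -/
theorem proportion_topDvd_and (π : R) {m d : ℕ} (hm : m ≤ d)
    (p : (Fin d → R) × (Fin d → R) → Prop) :
    proportion (fun y => TopDvd π m y.2 ∧ p y) =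
      proportion (fun x : R => π ∣ x) ^ m *
        proportion (fun y : (Fin d → R) × (Fin d → R) => p (y.1, scaleTop π m d y.2)) := by
  have h := ncard_comp_mul_ncard_range
    ((AddMonoidHom.id (Fin d → R)).prodMap (scaleTop π m d)) p
  have hr : Set.range ((AddMonoidHom.id (Fin d → R)).prodMap (scaleTop π m d)) =
      Set.univ ×ˢ {c | TopDvd π m c} := by
    ext ⟨a, c⟩
    simp only [Set.mem_prod, Set.mem_univ, true_and, Set.mem_ofPred_eq, ← mem_range_scaleTop]
    simp
  have hs : {h | h ∈ Set.range ((AddMonoidHom.id (Fin d → R)).prodMap (scaleTop π m d)) ∧ p h} =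
      {y | TopDvd π m y.2 ∧ p y} := by
    rw [hr]; ext; simp
  rw [hs, hr, Set.ncard_prod, ncard_topDvd π hm, Set.ncard_univ, Nat.card_prod] at h
  have hR : (Nat.card R : ℝ) ≠ 0 := card_pos_real.ne'
  have h' := congrArg (Nat.cast : ℕ → ℝ) h
  simp only [Nat.card_fun, Nat.card_fin, Nat.cast_mul, Nat.cast_pow] at h'
  simp only [proportion, Nat.card_prod, Nat.card_fun, Nat.card_fin, Nat.cast_mul, Nat.cast_pow,
    div_pow]
  have e : (Nat.card R : ℝ) ^ d = (Nat.card R : ℝ) ^ m * (Nat.card R : ℝ) ^ (d - m) := by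
    rw [← pow_add]; congr 1; omega
  have hm0 : (Nat.card R : ℝ) ^ m ≠ 0 := pow_ne_zero _ hR
  have hdm0 : (Nat.card R : ℝ) ^ (d - m) ≠ 0 := pow_ne_zero _ hR
  rw [e] at h' ⊢
  have h5 : ({y : (Fin d → R) × (Fin d → R) | TopDvd π m y.2 ∧ p y}.ncard : ℝ) *
      (Nat.card R : ℝ) ^ m = ({y : (Fin d → R) × (Fin d → R) |
        p (y.1, scaleTop π m d y.2)}.ncard : ℝ) * ({x | π ∣ x}.ncard : ℝ) ^ m := by
    have hne : (Nat.card R : ℝ) ^ m * ((Nat.card R : ℝ) ^ (d - m) * (Nat.card R : ℝ) ^ (d - m)) ≠ 0 :=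
      mul_ne_zero hm0 (mul_ne_zero hdm0 hdm0)
    refine mul_right_cancel₀ hne ?_
    have h6 : ({g : (Fin d → R) × (Fin d → R) |
        p (((AddMonoidHom.id (Fin d → R)).prodMap (scaleTop π m d)) g)}.ncard : ℝ) =
      ({y : (Fin d → R) × (Fin d → R) | p (y.1, scaleTop π m d y.2)}.ncard : ℝ) := rfl
    rw [h6] at h'
    linear_combination -h'
  field_simp
  linear_combination h5

theorem proportion_isUnit {π : R} (hπ : ∀ x, IsUnit x ∨ π ∣ x) (hπu : ¬ IsUnit π) :
    proportion (fun x : R => IsUnit x) = 1 - proportion (fun x : R => π ∣ x) := by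
  have h : {x : R | IsUnit x} = {x | π ∣ x}ᶜ := by
    ext x
    simp only [Set.mem_ofPred_eq, Set.mem_compl_iff]
    exact ⟨fun hx hd => hπu (isUnit_of_dvd_unit hd hx), fun hx => (hπ x).resolve_right hx⟩
  have h2 := Set.ncard_add_ncard_compl {x | π ∣ x}
  rw [← h] at h2
  have hR : (Nat.card R : ℝ) ≠ 0 := card_pos_real.ne'
  rw [proportion, proportion, eq_sub_iff_add_eq, ← add_div, div_eq_one_iff_eq hR, add_comm]
  exact_mod_cast h2

theorem proportion_coord_and {d : ℕ} (i : Fin d) (Z : R → Prop)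
    (p : (Fin d → R) × (Fin d → R) → Prop)
    (hp : ∀ a c s, p (a, Function.update c i s) ↔ p (a, c)) :
    proportion (fun y : (Fin d → R) × (Fin d → R) => Z (y.2 i) ∧ p y) =
      proportion Z * proportion p := by
  have h := congrArg (Nat.cast : ℕ → ℝ) (ncard_coord_and i Z p hp)
  have hR : (Nat.card R : ℝ) ≠ 0 := card_pos_real.ne'
  simp only [Nat.cast_mul] at h
  simp only [proportion, Nat.card_prod, Nat.card_fun, Nat.card_fin, Nat.cast_mul, Nat.cast_pow]
  field_simp
  linear_combination h

/-- Splitting according to the first coefficient, by decreasing index, that is a unit. -/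
theorem proportion_eq_sum_hasStep {π : R} (hπ : ∀ x, IsUnit x ∨ π ∣ x) (hπu : ¬ IsUnit π)
    {m d : ℕ} (hm : m ≤ d) (p : (Fin d → R) × (Fin d → R) → Prop) :
    proportion p = ∑ i ∈ Finset.range m, proportion (fun y => HasStep π (i + 1) y.2 ∧ p y) +
      proportion (fun y => TopDvd π m y.2 ∧ p y) := by
  induction m with
  | zero =>
    have : ∀ c : Fin d → R, TopDvd π 0 c := fun c i hi => by omega
    simp [this]
  | succ m ih =>
    rw [ih (by omega), Finset.sum_range_succ, add_assoc, add_right_inj]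
    have h : {y : (Fin d → R) × (Fin d → R) | TopDvd π m y.2 ∧ p y} =
        {y | HasStep π (m + 1) y.2 ∧ p y} ∪ {y | TopDvd π (m + 1) y.2 ∧ p y} := by
      ext y
      simp only [Set.mem_union, Set.mem_ofPred_eq, hasStep_iff, topDvd_succ_iff]
      constructor
      · rintro ⟨h1, h2⟩
        rcases hπ (y.2 ⟨d - (m + 1), by omega⟩) with h3 | h3
        · refine Or.inl ⟨⟨h1, fun i hi => ?_⟩, h2⟩
          rwa [show i = ⟨d - (m + 1), by omega⟩ from Fin.ext (by simp only; omega)]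
        · refine Or.inr ⟨⟨h1, fun i hi => ?_⟩, h2⟩
          rwa [show i = ⟨d - (m + 1), by omega⟩ from Fin.ext (by simp only; omega)]
      · rintro (⟨⟨h1, -⟩, h2⟩ | ⟨⟨h1, -⟩, h2⟩) <;> exact ⟨h1, h2⟩
    have hdisj : Disjoint {y : (Fin d → R) × (Fin d → R) | HasStep π (m + 1) y.2 ∧ p y}
        {y | TopDvd π (m + 1) y.2 ∧ p y} := by
      rw [Set.disjoint_left]
      rintro y ⟨h1, -⟩ ⟨h2, -⟩
      exact hπu (isUnit_of_dvd_unit (h2 ⟨d - (m + 1), by omega⟩ (by simp only; omega))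
        (h1.2 ⟨d - (m + 1), by omega⟩ (by simp only; omega)))
    rw [proportion, h, Set.ncard_union_eq hdisj, Nat.cast_add, add_div]
    rfl

/-- In length m + 1 only the coefficient of index 0 escapes the scaling; as `p'` ignores it, its
being a unit is an independent event. -/
theorem proportion_hasStep_self_and {π : R} (hπ : ∀ x, IsUnit x ∨ π ∣ x) (hπu : ¬ IsUnit π)
    {m : ℕ} (p p' : (Fin (m + 1) → R) × (Fin (m + 1) → R) → Prop)
    (hpp' : ∀ y, p (y.1, scaleTop π m (m + 1) y.2) ↔ p' y)
    (hp' : ∀ a c s, p' (a, Function.update c 0 s) ↔ p' (a, c)) :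
    proportion (fun y => HasStep π (m + 1) y.2 ∧ p y) =
      (1 - proportion (fun x : R => π ∣ x)) * proportion (fun x : R => π ∣ x) ^ m *
        proportion p' := by
  have h : ∀ c : Fin (m + 1) → R, HasStep π (m + 1) c ↔ TopDvd π m c ∧ IsUnit (c 0) := by
    intro c
    rw [hasStep_iff]
    refine and_congr_right fun _ => ⟨fun h => h 0 (by simp), fun h i hi => ?_⟩
    rwa [show i = 0 from Fin.ext (by simp only [Fin.val_zero]; omega)]
  simp only [h, and_assoc]
  rw [proportion_topDvd_and π (by omega) (fun y => IsUnit (y.2 0) ∧ p y)]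
  have h0 : ∀ c : Fin (m + 1) → R, scaleTop π m (m + 1) c 0 = c 0 := fun c => by
    rw [scaleTop_apply, if_neg (by simp)]
  simp only [h0, hpp']
  rw [proportion_coord_and 0 _ _ hp', proportion_isUnit hπ hπu]
  ring

end Scaling

/-! ### The recursion for Hankel determinants. -/

section Recursion

variable {R : Type*} [CommRing R]

/-- The probability that `π ^ w` divides the Hankel determinant of size `n` of a random pair. -/
noncomputable def hankelProb (π : R) (d n w : ℕ) : ℝ :=
  proportion (fun y : (Fin d → R) × (Fin d → R) => π ^ w ∣ hankelDetOfCoeffs n y)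

theorem hankelProb_size_zero {π : R} (hπu : ¬ IsUnit π) (d w : ℕ) :
    hankelProb π d 0 (w + 1) = 0 := by
  have : ∀ y : (Fin d → R) × (Fin d → R), ¬ π ^ (w + 1) ∣ hankelDetOfCoeffs 0 y := by
    intro y hy
    rw [hankelDetOfCoeffs, hankelDet_zero] at hy
    exact hπu (isUnit_of_dvd_one ((dvd_pow_self π (Nat.succ_ne_zero w)).trans hy))
  simp [hankelProb, this, proportion]

variable [Nontrivial R]

theorem residueAtInfinity_X_pow_mul_lowPoly {d : ℕ} {A : R[X]} (hA : A.Monic)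
    (hAd : A.natDegree = d) (m : ℕ) (c : Fin d → R) :
    residueAtInfinity A (X ^ m * lowPoly c) =
      ∑ i : Fin d, if d ≤ (i : ℕ) + m + 1 then c i * residueAtInfinity A (X ^ (m + i)) else 0 := by
  rw [lowPoly, Finset.mul_sum, map_sum]
  refine Finset.sum_congr rfl fun i _ => ?_
  rw [mul_left_comm, ← smul_eq_C_mul, map_smul, smul_eq_mul, ← pow_add]
  split_ifs with h
  · rfl
  · rw [residueAtInfinity_X_pow_eq_zero hA (by omega), mul_zero]

/-- A determinant of size n > 0 involves only the min(d, 2n - 1) top coefficients of the numerator;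
once they are all scaled, every entry gains a factor π. -/
theorem hankelDetOfCoeffs_scaleTop (π : R) {d n m : ℕ} (hm : d ≤ m ∨ 2 * n ≤ m + 1)
    (a c : Fin d → R) :
    hankelDetOfCoeffs n (a, scaleTop π m d c) = π ^ n * hankelDetOfCoeffs n (a, c) := by
  refine hankelDet_smul fun l hl => ?_
  rw [residueAtInfinity_X_pow_mul_lowPoly (monic_monicOfCoeffs a) (natDegree_monicOfCoeffs a),
    residueAtInfinity_X_pow_mul_lowPoly (monic_monicOfCoeffs a) (natDegree_monicOfCoeffs a),
    Finset.mul_sum]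
  refine Finset.sum_congr rfl fun i _ => ?_
  split_ifs with h
  · dsimp only
    rw [scaleTop_apply, if_pos (by omega), mul_assoc]
  · rw [mul_zero]

theorem hankelDetOfCoeffs_update {d n : ℕ} (i : Fin d) (hi : (i : ℕ) + 2 * n ≤ d)
    (a c : Fin d → R) (s : R) :
    hankelDetOfCoeffs n (a, Function.update c i s) = hankelDetOfCoeffs n (a, c) := by
  refine hankelDet_congr fun l hl => ?_
  rw [residueAtInfinity_X_pow_mul_lowPoly (monic_monicOfCoeffs a) (natDegree_monicOfCoeffs a),
    residueAtInfinity_X_pow_mul_lowPoly (monic_monicOfCoeffs a) (natDegree_monicOfCoeffs a)]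
  refine Finset.sum_congr rfl fun i' _ => ?_
  split_ifs with h
  · dsimp only
    rw [Function.update_of_ne]
    rintro rfl
    omega
  · rfl

variable [Finite R]

theorem hankelProb_zero (π : R) (d n : ℕ) : hankelProb π d n 0 = 1 := by
  simp only [hankelProb, pow_zero, isUnit_one.dvd, proportion]
  rw [Set.ofPred_true, Set.ncard_univ, div_self]
  exact_mod_cast Nat.card_pos.ne'

/-- The recursion satisfied by the distribution of the valuation of the Hankel determinants. -/
theorem hankelProb_recursion {π : R} (hπ : ∀ x, IsUnit x ∨ π ∣ x) (hnil : IsNilpotent π) {N : ℕ}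
    (hval : ∀ (a b : ℕ) (x : R), b ≤ N → π ^ b ∣ π ^ a * x → π ^ (b - a) ∣ x)
    {d n w : ℕ} (hnd : n ≤ d) (hn : 0 < n) (hw : w ≤ N) :
    hankelProb π d n w = ∑ i ∈ Finset.range (min d (2 * n - 1)),
      (1 - proportion (fun x : R => π ∣ x)) * proportion (fun x : R => π ∣ x) ^ i *
        (if i + 1 ≤ n then hankelProb π (d - (i + 1)) (n - (i + 1)) w
          else hankelProb π (i + 1) (i + 1 - n) (w - (i + 1 - n))) +
      proportion (fun x : R => π ∣ x) ^ (min d (2 * n - 1)) * hankelProb π d n (w - n) := by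
  have hπu : ¬ IsUnit π := hnil.not_isUnit
  have hdvd : ∀ (r : ℕ) (x : R), π ^ w ∣ π ^ r * x ↔ π ^ (w - r) ∣ x := by
    intro r x
    refine ⟨hval r w x hw, fun h => ?_⟩
    refine (pow_dvd_pow π (show w ≤ r + (w - r) by omega)).trans ?_
    rw [pow_add]
    exact mul_dvd_mul_left _ h
  have hR : (Nat.card R : ℝ) ≠ 0 := card_pos_real.ne'
  rw [hankelProb, proportion_eq_sum_hasStep hπ hπu (min_le_left d (2 * n - 1))]
  congr 1
  · refine Finset.sum_congr rfl fun i hi => ?_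
    rw [Finset.mem_range, lt_min_iff] at hi
    obtain ⟨e, rfl⟩ : ∃ e, d = e + (i + 1) := ⟨d - (i + 1), by omega⟩
    split_ifs with hin
    · obtain ⟨l, rfl⟩ : ∃ l, n = (i + 1) + l := ⟨n - (i + 1), by omega⟩
      have h1 := congrArg (Nat.cast : ℕ → ℝ)
        (ncard_hasStep_dvd_of_le (e := e) hnil (Nat.succ_pos i) (l := l) (by omega) (π ^ w))
      have h2 := proportion_hasStep_self_and hπ hπu (m := i) (fun _ => True) (fun _ => True)
        (fun _ => Iff.rfl) (fun _ _ _ => Iff.rfl)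
      simp only [and_true] at h2
      have h3 : proportion (fun _ : (Fin (i + 1) → R) × (Fin (i + 1) → R) => True) = 1 := by
        rw [proportion, Set.ofPred_true, Set.ncard_univ, div_self]
        exact_mod_cast Nat.card_pos.ne'
      rw [h3, mul_one] at h2
      rw [← h2, Nat.add_sub_cancel, Nat.add_sub_cancel_left, hankelProb, proportion, proportion,
        proportion]
      rw [Nat.cast_mul] at h1
      simp only [Nat.succ_eq_add_one] at h1
      rw [h1]
      simp only [Nat.card_prod, Nat.card_fun, Nat.card_fin, Nat.cast_mul, Nat.cast_pow]
      field_simp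
      ring
    -- From i + 1 < 2n follows 2r ≤ i: the dual determinant sees only the 2r - 1 top coefficients,
    -- all of them scaled, and not the unit of index 0.
    · set r := i + 1 - n with hr
      have h1 := congrArg (Nat.cast : ℕ → ℝ)
        (ncard_hasStep_dvd_of_ge (e := e) hnil (Nat.succ_pos i) (n := n) (by omega) (π ^ w))
      rw [ncard_hasStep_dvd_dual hnil (Nat.succ_pos i) (r := r) (by omega)] at h1
      have h2 := proportion_hasStep_self_and hπ hπu (m := i)
        (fun y => π ^ w ∣ hankelDetOfCoeffs r y) (fun y => π ^ (w - r) ∣ hankelDetOfCoeffs r y)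
        (fun y => by rw [hankelDetOfCoeffs_scaleTop π (by omega), hdvd])
        (fun a c s => by rw [hankelDetOfCoeffs_update 0 (by simp only [Fin.val_zero]; omega)])
      rw [hankelProb, ← h2, proportion, proportion]
      simp only [Nat.succ_eq_add_one, Nat.cast_mul, Nat.cast_pow] at h1
      rw [h1]
      simp only [Nat.card_prod, Nat.card_fun, Nat.card_fin, Nat.cast_mul, Nat.cast_pow]
      field_simp
      ring
  · rw [proportion_topDvd_and π (min_le_left _ _), hankelProb]
    congr 2
    ext y
    rw [hankelDetOfCoeffs_scaleTop π (by omega), hdvd]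

end Recursion

/-! ### Sums of minima over nested windows. -/

section MinSum

/-- The sum of the minima of `g` over the intervals of center `n - 1` and radius `< n`. -/
noncomputable def minSum (n : ℕ) (g : ℕ → ℕ∞) : ℕ∞ :=
  ∑ s ∈ Finset.range n, (Finset.Icc (n - 1 - s) (n - 1 + s)).inf g

theorem inf_add_one {S : Finset ℕ} (hS : S.Nonempty) (g : ℕ → ℕ∞) :
    S.inf (fun i => g i + 1) = S.inf g + 1 := by
  refine le_antisymm ?_ (Finset.le_inf fun i hi => by gcongr; exact Finset.inf_le hi)
  obtain ⟨i, hi, h⟩ := Finset.exists_mem_eq_inf S hS g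
  rw [h]
  exact Finset.inf_le (f := fun i => g i + 1) hi

theorem inf_Icc_add (a b c : ℕ) (g : ℕ → ℕ∞) :
    (Finset.Icc (a + c) (b + c)).inf g = (Finset.Icc a b).inf fun i => g (i + c) := by
  rw [← Finset.image_add_right_Icc, Finset.inf_image]
  rfl

theorem minSum_congr {n : ℕ} {g g' : ℕ → ℕ∞} (h : ∀ i, i + 1 < 2 * n → g i = g' i) :
    minSum n g = minSum n g' := by
  refine Finset.sum_congr rfl fun s hs => Finset.inf_congr rfl fun i hi => h i ?_
  rw [Finset.mem_range] at hs
  rw [Finset.mem_Icc] at hi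
  omega

theorem minSum_add_one {n : ℕ} {g g' : ℕ → ℕ∞} (h : ∀ i, i + 1 < 2 * n → g i = g' i + 1) :
    minSum n g = n + minSum n g' := by
  rw [minSum_congr h, minSum]
  simp_rw [fun s => inf_add_one (Finset.nonempty_Icc.2 (show n - 1 - s ≤ n - 1 + s by omega)) g']
  rw [Finset.sum_add_distrib, add_comm]
  simp [minSum]

/-- A zero at distance r from the centre n - 1 lies in every window of radius at least r. On the
left, r < n keeps the index `n - 1 - r` from being truncated. -/
theorem minSum_eq_of_zero {n r c : ℕ} {g : ℕ → ℕ∞} (hrn : r ≤ n) (hc : r + c = n)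
    (h0 : g (n - 1 + r) = 0 ∨ (r < n ∧ g (n - 1 - r) = 0)) :
    minSum n g = minSum r fun i => g (i + c) := by
  rw [minSum, minSum, ← Finset.sum_subset (Finset.range_mono hrn)]
  · refine Finset.sum_congr rfl fun s hs => ?_
    rw [Finset.mem_range] at hs
    rw [← inf_Icc_add]
    congr 2 <;> omega
  · intro s hs hs'
    rw [Finset.mem_range] at hs hs'
    rw [← nonpos_iff_eq_zero]
    rcases h0 with h0 | ⟨_, h0⟩
    · exact (Finset.inf_le (Finset.mem_Icc.2 ⟨by omega, by omega⟩)).trans h0.le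
    · exact (Finset.inf_le (Finset.mem_Icc.2 ⟨by omega, by omega⟩)).trans h0.le

theorem natCast_le_add_iff (w r : ℕ) (y : ℕ∞) :
    (w : ℕ∞) ≤ r + y ↔ ((w - r : ℕ) : ℕ∞) ≤ y := by
  induction y using ENat.recTopCoe with
  | top => simp
  | coe y => norm_cast; omega

/-- The extension of a finite sequence by `∞`. -/
noncomputable def extendTop {d : ℕ} (x : Fin d → ℕ) (i : ℕ) : ℕ∞ :=
  if h : i < d then (x ⟨i, h⟩ : ℕ∞) else ⊤

end MinSum

/-! ### Independence and memorylessness on product measures. -/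

section PiMeasure

open scoped ENNReal

variable {ν : Measure ℕ} [IsProbabilityMeasure ν]

theorem pi_inter_comp {d d' : ℕ} {e : Fin d' → Fin d} (he : Function.Injective e)
    (S : Fin d → Set ℕ) (q : (Fin d' → ℕ) → Prop) :
    (Measure.pi fun _ : Fin d => ν) {x | (∀ i, i ∉ Set.range e → x i ∈ S i) ∧ q (x ∘ e)} =
      (∏ i ∈ (Finset.univ.image e)ᶜ, ν (S i)) * (Measure.pi fun _ : Fin d' => ν) {y | q y} := by
  set A : Set (Fin d → ℕ) := {x | ∀ i, i ∉ Set.range e → x i ∈ S i} with hA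
  have hmeas : Measurable fun x : Fin d → ℕ => x ∘ e := Measurable.of_discrete
  have key : (((Measure.pi fun _ : Fin d => ν).restrict A).map fun x => x ∘ e) =
      (∏ i ∈ (Finset.univ.image e)ᶜ, ν (S i)) • (Measure.pi fun _ : Fin d' => ν) := by
    refine Measure.ext_of_singleton fun y => ?_
    rw [Measure.map_apply hmeas (MeasurableSet.of_discrete),
      Measure.restrict_apply (MeasurableSet.of_discrete), Measure.smul_apply, smul_eq_mul,
      Measure.pi_singleton]
    have hbox : (fun x : Fin d → ℕ => x ∘ e) ⁻¹' {y} ∩ A =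
        Set.univ.pi (Function.extend e (fun j => {y j}) S) := by
      ext x
      simp only [Set.mem_inter_iff, Set.mem_preimage, Set.mem_singleton_iff, hA,
        Set.mem_ofPred_eq, Set.mem_pi, Set.mem_univ, true_implies]
      constructor
      · rintro ⟨h1, h2⟩ i
        by_cases hi : i ∈ Set.range e
        · obtain ⟨j, rfl⟩ := hi
          rw [he.extend_apply]
          exact congrFun h1 j
        · rw [Function.extend_apply' _ _ _ hi]
          exact h2 i hi
      · intro h
        refine ⟨?_, fun i hi => ?_⟩
        · ext j
          have := h (e j)
          rwa [he.extend_apply] at this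
        · have := h i
          rwa [Function.extend_apply' _ _ _ hi] at this
    rw [hbox, Measure.pi_pi, ← Finset.prod_compl_mul_prod (Finset.univ.image e),
      Finset.prod_image fun a _ b _ h => he h]
    congr 1
    · refine Finset.prod_congr rfl fun i hi => ?_
      rw [Function.extend_apply']
      simpa using hi
    · exact Finset.prod_congr rfl fun j _ => by rw [he.extend_apply]
  have h := congrArg (fun m => m {y | q y}) key
  simp only [Measure.smul_apply, smul_eq_mul] at h
  rw [← h, Measure.map_apply hmeas (MeasurableSet.of_discrete),
    Measure.restrict_apply (MeasurableSet.of_discrete)]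
  congr 1
  ext x
  simp [hA, and_comm]

theorem pi_comp {d d' : ℕ} {e : Fin d' → Fin d} (he : Function.Injective e)
    (q : (Fin d' → ℕ) → Prop) :
    (Measure.pi fun _ : Fin d => ν).real {x | q (x ∘ e)} =
      (Measure.pi fun _ : Fin d' => ν).real {y | q y} := by
  have := pi_inter_comp (ν := ν) he (fun _ => Set.univ) q
  simp only [Set.mem_univ, implies_true, true_and, measure_univ, Finset.prod_const_one,
    one_mul] at this
  rw [Measure.real, this, Measure.real]

theorem pi_coord_and_comp {d d' : ℕ} {e : Fin d' → Fin d} (he : Function.Injective e) {i : Fin d}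
    (hi : i ∉ Set.range e) (Z : Set ℕ) (q : (Fin d' → ℕ) → Prop) :
    (Measure.pi fun _ : Fin d => ν).real {x | x i ∈ Z ∧ q (x ∘ e)} =
      ν.real Z * (Measure.pi fun _ : Fin d' => ν).real {y | q y} := by
  have := pi_inter_comp (ν := ν) he (fun i' => if i' = i then Z else Set.univ) q
  rw [Finset.prod_eq_single i] at this
  · rw [if_pos rfl] at this
    rw [Measure.real, Measure.real, Measure.real, ← ENNReal.toReal_mul, ← this]
    congr 2
    ext x
    simp only [Set.mem_ofPred_eq]
    refine and_congr_left fun _ => ⟨fun h i' hi' => ?_, fun h => by simpa using h i hi⟩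
    split_ifs with h1
    · rwa [h1]
    · trivial
  · intro i' _ h
    rw [if_neg h, measure_univ]
  · intro h
    refine absurd ?_ h
    simpa using hi

/-- Adding one to the `m` first terms. -/
def addOneFirst (m : ℕ) {d : ℕ} (x : Fin d → ℕ) (i : Fin d) : ℕ :=
  if (i : ℕ) < m then x i + 1 else x i

/-- `hν` is memorylessness: restricted to positive integers, ν is t times its shift by one. It is
applied in each of the first m coordinates. -/
theorem pi_first_pos_and {t : ℝ≥0∞} (hν : ∀ s : Set ℕ, ν ({0}ᶜ ∩ s) = t * ν (Nat.succ ⁻¹' s))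
    {m d : ℕ} (hm : m ≤ d) (p : (Fin d → ℕ) → Prop) :
    (Measure.pi fun _ : Fin d => ν).real {x | (∀ i : Fin d, (i : ℕ) < m → x i ≠ 0) ∧ p x} =
      t.toReal ^ m * (Measure.pi fun _ : Fin d => ν).real {x | p (addOneFirst m x)} := by
  classical
  set S : Fin d → Set ℕ := fun i => if (i : ℕ) < m then {0}ᶜ else Set.univ with hS
  set c : Fin d → ℝ≥0∞ := fun i => if (i : ℕ) < m then t else 1 with hc
  set f : Fin d → ℕ → ℕ := fun i a => if (i : ℕ) < m then a + 1 else a with hf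
  have hmeas : Measurable (addOneFirst m (d := d)) := Measurable.of_discrete
  have key : Measure.pi (fun i => ν.restrict (S i)) =
      (∏ i, c i) • (Measure.pi fun _ : Fin d => ν).map (addOneFirst m) := by
    refine Measure.pi_eq fun s _ => ?_
    have hpre : addOneFirst m ⁻¹' (Set.univ.pi s) = Set.univ.pi fun i => f i ⁻¹' s i := by
      ext x
      simp [addOneFirst, hf]
    rw [Measure.smul_apply, smul_eq_mul, Measure.map_apply hmeas (MeasurableSet.of_discrete),
      hpre, Measure.pi_pi, ← Finset.prod_mul_distrib]
    refine Finset.prod_congr rfl fun i _ => ?_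
    rw [Measure.restrict_apply (MeasurableSet.of_discrete)]
    by_cases hi : (i : ℕ) < m
    · simp only [hc, hf, hS, if_pos hi]
      rw [Set.inter_comm, hν]
    · simp [hc, hf, hS, if_neg hi]
  rw [← Measure.restrict_pi_pi] at key
  have h := congrArg (fun μ => (μ {x | p x}).toReal) key
  simp only [Measure.smul_apply, smul_eq_mul, ENNReal.toReal_mul] at h
  rw [Measure.restrict_apply (MeasurableSet.of_discrete),
    Measure.map_apply hmeas (MeasurableSet.of_discrete)] at h
  have hprod : (∏ i, c i) = t ^ m := by
    rw [hc, Fin.prod_univ_eq_prod_range (fun i => if i < m then t else 1) d, Finset.prod_ite,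
      Finset.prod_const_one, mul_one, Finset.prod_const]
    congr 1
    have : (Finset.range d).filter (fun i => i < m) = Finset.range m := by
      ext i; simp; omega
    rw [this, Finset.card_range]
  rw [hprod, ENNReal.toReal_pow] at h
  rw [Measure.real, Measure.real]
  refine Eq.trans ?_ h
  congr 2
  ext x
  simp only [Set.mem_ofPred_eq, Set.mem_inter_iff, Set.mem_pi, Set.mem_univ, true_implies, hS]
  rw [and_comm]
  refine and_congr_right fun _ => forall_congr' fun i => ?_
  by_cases hi : (i : ℕ) < m <;> simp [hi]

end PiMeasure

/-! ### The recursion for sums of minima. -/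

section GeometricRecursion

open scoped ENNReal

variable (ν : Measure ℕ)

/-- The probability that the sum of the minima is at least `w`. -/
noncomputable def minSumProb (d n w : ℕ) : ℝ :=
  (Measure.pi fun _ : Fin d => ν).real {x | (w : ℕ∞) ≤ minSum n (extendTop x)}

theorem minSumProb_size_zero (d w : ℕ) : minSumProb ν d 0 (w + 1) = 0 := by
  have : ∀ x : Fin d → ℕ, ¬ ((w + 1 : ℕ) : ℕ∞) ≤ minSum 0 (extendTop x) := fun x => by
    simp [minSum]
  simp only [minSumProb, this]
  simp

variable [IsProbabilityMeasure ν]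

theorem minSumProb_zero (d n : ℕ) : minSumProb ν d n 0 = 1 := by
  simp [minSumProb, Set.ofPred_true]

/-- All windows lie among the first 2n - 1 indices, so the number of variables beyond them is
immaterial. -/
theorem minSumProb_eq_of_le {d d' n : ℕ} (hd : d' ≤ d) (hn : 2 * n ≤ d' + 1) (w : ℕ) :
    minSumProb ν d' n w = minSumProb ν d n w := by
  rw [minSumProb, ← pi_comp (Fin.castLE_injective hd)]
  unfold minSumProb
  congr 1
  ext x
  simp only [Set.mem_ofPred_eq]
  rw [minSum_congr]
  intro i hi
  rw [extendTop, extendTop, dif_pos (by omega), dif_pos (by omega)]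
  rfl

theorem pi_eq_sum_first_zero {m d : ℕ} (hm : m ≤ d) (p : (Fin d → ℕ) → Prop) :
    (Measure.pi fun _ : Fin d => ν).real {x | p x} =
      ∑ i ∈ Finset.range m, (Measure.pi fun _ : Fin d => ν).real
        {x | (∀ i' : Fin d, (i' : ℕ) < i → x i' ≠ 0) ∧
          (∀ i' : Fin d, (i' : ℕ) = i → x i' = 0) ∧ p x} +
      (Measure.pi fun _ : Fin d => ν).real
        {x | (∀ i' : Fin d, (i' : ℕ) < m → x i' ≠ 0) ∧ p x} := by
  induction m with
  | zero => simp
  | succ m ih =>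
    rw [ih (by omega), Finset.sum_range_succ, add_assoc, add_right_inj,
      ← measureReal_union _ MeasurableSet.of_discrete]
    · congr 1
      ext x
      simp only [Set.mem_union, Set.mem_ofPred_eq]
      constructor
      · rintro ⟨h1, h2⟩
        by_cases h3 : x ⟨m, by omega⟩ = 0
        · exact Or.inl ⟨h1, fun i hi => by rwa [show i = ⟨m, by omega⟩ from Fin.ext hi], h2⟩
        · refine Or.inr ⟨fun i hi => ?_, h2⟩
          rcases Nat.lt_succ_iff_lt_or_eq.1 hi with hi | hi
          · exact h1 i hi
          · rwa [show i = ⟨m, by omega⟩ from Fin.ext hi]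
      · rintro (⟨h1, -, h2⟩ | ⟨h1, h2⟩)
        · exact ⟨h1, h2⟩
        · exact ⟨fun i hi => h1 i (by omega), h2⟩
    · rw [Set.disjoint_left]
      rintro x ⟨-, h1, -⟩ ⟨h2, -⟩
      exact h2 ⟨m, by omega⟩ (Nat.lt_succ_self m) (h1 ⟨m, by omega⟩ rfl)

/-- The recursion satisfied by the distribution of the sum of the minima. -/
theorem minSumProb_recursion {t : ℝ≥0∞}
    (hν : ∀ s : Set ℕ, ν ({0}ᶜ ∩ s) = t * ν (Nat.succ ⁻¹' s)) (hν0 : ν.real {0} = 1 - t.toReal)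
    {d n : ℕ} (w : ℕ) (hn : 0 < n) :
    minSumProb ν d n w = ∑ i ∈ Finset.range (min d (2 * n - 1)),
      (1 - t.toReal) * t.toReal ^ i *
        (if i + 1 ≤ n then minSumProb ν (d - (i + 1)) (n - (i + 1)) w
          else minSumProb ν (i + 1) (i + 1 - n) (w - (i + 1 - n))) +
      t.toReal ^ (min d (2 * n - 1)) * minSumProb ν d n (w - n) := by
  rw [minSumProb, pi_eq_sum_first_zero ν (min_le_left d (2 * n - 1))]
  congr 1
  · refine Finset.sum_congr rfl fun i hi => ?_
    rw [Finset.mem_range, lt_min_iff] at hi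
    have hzero : ∀ x : Fin d → ℕ,
        (∀ i' : Fin d, (i' : ℕ) = i → addOneFirst i x i' = 0) ↔ x ⟨i, hi.1⟩ ∈ ({0} : Set ℕ) := by
      intro x
      have h1 : ∀ i' : Fin d, (i' : ℕ) = i → addOneFirst i x i' = x i' := fun i' hi' => by
        rw [addOneFirst, if_neg (by omega)]
      constructor
      · intro h
        have := h ⟨i, hi.1⟩ rfl
        rwa [h1 _ rfl] at this
      · intro h i' hi'
        rw [h1 _ hi', show i' = ⟨i, hi.1⟩ from Fin.ext hi']
        exact h
    have hext : ∀ x : Fin d → ℕ, x ⟨i, hi.1⟩ ∈ ({0} : Set ℕ) →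
        extendTop (addOneFirst i x) i = 0 := by
      intro x hx
      rw [Set.mem_singleton_iff] at hx
      simp [extendTop, hi.1, addOneFirst, hx]
    rw [pi_first_pos_and hν hi.1.le]
    simp only [hzero]
    split_ifs with hin
    · set e : Fin (d - (i + 1)) → Fin d := fun j => ⟨j + (i + 1), by omega⟩ with he
      have hinj : Function.Injective e := fun a b hab => by
        have := congrArg Fin.val hab
        simp only [he] at this
        exact Fin.ext (by omega)
      have hnot : (⟨i, hi.1⟩ : Fin d) ∉ Set.range e := by
        rintro ⟨j, hj⟩
        have := congrArg Fin.val hj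
        simp only [he] at this
        omega
      have h1 := pi_coord_and_comp (ν := ν) hinj hnot {0}
        (fun y => (w : ℕ∞) ≤ minSum (n - (i + 1)) (extendTop y))
      rw [hν0] at h1
      rw [minSumProb, mul_comm (1 - t.toReal), mul_assoc, ← h1]
      congr 2
      ext x
      refine and_congr_right fun hx => ?_
      rw [minSum_eq_of_zero (r := n - (i + 1)) (c := i + 1) (by omega) (by omega)
        (Or.inr ⟨by omega, by rw [show n - 1 - (n - (i + 1)) = i by omega]; exact hext x hx⟩)]
      have : (fun i' => extendTop (addOneFirst i x) (i' + (i + 1))) = extendTop (x ∘ e) := by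
        ext1 i'
        by_cases h : i' + (i + 1) < d
        · rw [extendTop, extendTop, dif_pos h, dif_pos (by omega), addOneFirst,
            if_neg (by simp only; omega)]
          rfl
        · rw [extendTop, extendTop, dif_neg h, dif_neg (by omega)]
      rw [this]
    · set r := i + 1 - n with hr
      -- The surviving windows cover the indices n - r, …, i - 1, all before the zero, where every
      -- variable has been raised by one.
      set e : Fin (2 * r - 1) → Fin d := fun j => ⟨j + (n - r), by omega⟩ with he
      have hinj : Function.Injective e := fun a b hab => by
        have := congrArg Fin.val hab
        simp only [he] at this
        exact Fin.ext (by omega)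
      have hnot : (⟨i, hi.1⟩ : Fin d) ∉ Set.range e := by
        rintro ⟨j, hj⟩
        have := congrArg Fin.val hj
        simp only [he] at this
        omega
      have h1 := pi_coord_and_comp (ν := ν) hinj hnot {0}
        (fun y => ((w - r : ℕ) : ℕ∞) ≤ minSum r (extendTop y))
      rw [hν0] at h1
      rw [← minSumProb_eq_of_le ν (d' := 2 * r - 1) (by omega) (by omega), minSumProb,
        mul_comm (1 - t.toReal), mul_assoc, ← h1]
      congr 2
      ext x
      refine and_congr_right fun hx => ?_
      rw [minSum_eq_of_zero (r := r) (c := n - r) (by omega) (by omega)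
        (Or.inl (by rw [show n - 1 + r = i by omega]; exact hext x hx)),
        minSum_add_one (g' := extendTop (x ∘ e)), natCast_le_add_iff]
      intro i' hi'
      rw [extendTop, extendTop, dif_pos (by omega), dif_pos (by omega), addOneFirst,
        if_pos (by simp only; omega)]
      push_cast
      rfl
  · rw [pi_first_pos_and hν (min_le_left _ _), minSumProb]
    congr 2
    ext x
    simp only [Set.mem_ofPred_eq]
    rw [minSum_add_one (g' := extendTop x), natCast_le_add_iff]
    intro i hi
    by_cases h : i < d
    · rw [extendTop, extendTop, dif_pos h, dif_pos h, addOneFirst, if_pos (by simp only; omega)]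
      push_cast
      rfl
    -- Beyond d both terms are infinite, and ∞ = ∞ + 1.
    · rw [extendTop, extendTop, dif_neg h, dif_neg h]
      rfl

end GeometricRecursion

/-! ### Uniqueness for the recursion. -/

section Comparison

/-- The recursion has a unique solution. -/
theorem recursion_unique {F G : ℕ → ℕ → ℕ → ℝ} {t : ℝ} {N : ℕ}
    (hF0 : ∀ d n, F d n 0 = 1) (hG0 : ∀ d n, G d n 0 = 1)
    (hF1 : ∀ d w, F d 0 (w + 1) = 0) (hG1 : ∀ d w, G d 0 (w + 1) = 0)
    (hF : ∀ d n w, n ≤ d → 0 < n → w ≤ N → F d n w =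
      ∑ i ∈ Finset.range (min d (2 * n - 1)), (1 - t) * t ^ i *
        (if i + 1 ≤ n then F (d - (i + 1)) (n - (i + 1)) w
          else F (i + 1) (i + 1 - n) (w - (i + 1 - n))) +
      t ^ (min d (2 * n - 1)) * F d n (w - n))
    (hG : ∀ d n w, n ≤ d → 0 < n → w ≤ N → G d n w =
      ∑ i ∈ Finset.range (min d (2 * n - 1)), (1 - t) * t ^ i *
        (if i + 1 ≤ n then G (d - (i + 1)) (n - (i + 1)) w
          else G (i + 1) (i + 1 - n) (w - (i + 1 - n))) +
      t ^ (min d (2 * n - 1)) * G d n (w - n)) :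
    ∀ w d n, n ≤ d → w ≤ N → F d n w = G d n w := by
  intro w
  induction w using Nat.strong_induction_on with
  | _ w ihw =>
    intro d
    induction d using Nat.strong_induction_on with
    | _ d ihd =>
      intro n hnd hw
      rcases Nat.eq_zero_or_pos w with rfl | hw0
      · rw [hF0, hG0]
      rcases Nat.eq_zero_or_pos n with rfl | hn0
      · obtain ⟨w, rfl⟩ : ∃ w', w = w' + 1 := ⟨w - 1, by omega⟩
        rw [hF1, hG1]
      -- The exponent w drops in the last term and in the terms with i + 1 > n; in the other terms w
      -- is unchanged but d drops.
      rw [hF d n w hnd hn0 hw, hG d n w hnd hn0 hw, ihw (w - n) (by omega) d n hnd (by omega)]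
      congr 1
      refine Finset.sum_congr rfl fun i hi => ?_
      rw [Finset.mem_range, lt_min_iff] at hi
      split_ifs with h
      · rw [ihd (d - (i + 1)) (by omega) (n - (i + 1)) (by omega) hw]
      · rw [ihw (w - (i + 1 - n)) (by omega) (i + 1) (i + 1 - n) (by omega) (by omega)]

end Comparison

/-! ### Equality of the two laws over a finite quotient. -/

section Geometric

open scoped ENNReal

theorem geometricMeasure_compl_zero_inter {p : unitInterval} (hp : p ≠ 0) (s : Set ℕ) :
    geometricMeasure p ({0}ᶜ ∩ s) =
      ENNReal.ofReal (1 - p) * geometricMeasure p (Nat.succ ⁻¹' s) := by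
  have key : (geometricMeasure p).restrict {0}ᶜ =
      ENNReal.ofReal (1 - p) • (geometricMeasure p).map Nat.succ := by
    refine Measure.ext_of_singleton fun n => ?_
    rw [Measure.restrict_apply MeasurableSet.of_discrete, Measure.smul_apply, smul_eq_mul,
      Measure.map_apply Measurable.of_discrete MeasurableSet.of_discrete]
    rcases n with _ | n
    · have h1 : Nat.succ ⁻¹' {0} = ∅ := by ext; simp
      simp [h1]
    · have h1 : Nat.succ ⁻¹' {n + 1} = {n} := by ext; simp
      have h2 : ({n + 1} : Set ℕ) ∩ {0}ᶜ = {n + 1} := by ext; simp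
      rw [h1, h2, geometricMeasure_singleton hp, geometricMeasure_singleton hp,
        ← ENNReal.ofReal_mul (sub_nonneg.2 p.2.2), pow_succ']
      congr 1
      ring
  have h := congrArg (fun μ => μ s) key
  simp only [Measure.smul_apply, smul_eq_mul] at h
  rwa [Measure.restrict_apply MeasurableSet.of_discrete, Set.inter_comm,
    Measure.map_apply Measurable.of_discrete MeasurableSet.of_discrete] at h

/-- Over a finite quotient of a discrete valuation ring, the Hankel determinants of random pairs
follow the law of the sums of minima of geometric variables. -/
theorem hankelProb_eq_minSumProb {R : Type*} [CommRing R] [Nontrivial R] [Finite R] {π : R}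
    (hπ : ∀ x, IsUnit x ∨ π ∣ x) (hnil : IsNilpotent π) {N : ℕ}
    (hval : ∀ (a b : ℕ) (x : R), b ≤ N → π ^ b ∣ π ^ a * x → π ^ (b - a) ∣ x)
    {p : unitInterval} (hp0 : p ≠ 0) (hp : (p : ℝ) = 1 - proportion (fun x : R => π ∣ x))
    {d n w : ℕ} (hnd : n ≤ d) (hw : w ≤ N) :
    hankelProb π d n w = minSumProb (geometricMeasure p) d n w := by
  have ht : (ENNReal.ofReal (1 - p)).toReal = proportion (fun x : R => π ∣ x) := by
    rw [ENNReal.toReal_ofReal (sub_nonneg.2 p.2.2), hp]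
    ring
  have hν0 : (geometricMeasure p).real {0} = 1 - (ENNReal.ofReal (1 - p)).toReal := by
    rw [geometricMeasure_real_singleton hp0, ht, ← hp]
    simp
  refine recursion_unique (t := proportion (fun x : R => π ∣ x)) (N := N)
    (hankelProb_zero π) (minSumProb_zero _) (hankelProb_size_zero hnil.not_isUnit)
    (minSumProb_size_zero _)
    (fun d n w hnd hn hw => hankelProb_recursion hπ hnil hval hnd hn hw)
    (fun d n w _ hn _ => ?_) w d n hnd hw
  rw [← ht]
  exact minSumProb_recursion _ (geometricMeasure_compl_zero_inter hp0) hν0 w hn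

end Geometric

/-! ### Reversing the indices. -/

section SumOfMins

theorem extendIndex_eq_extendTop {d : ℕ} (x : Fin d → ℕ) (i : ℕ) :
    extendIndex x ((d : ℤ) - 1 - i) = extendTop (x ∘ Fin.rev) i := by
  by_cases h : i < d
  · have h1 : ((d : ℤ) - 1 - i).toNat = d - 1 - i := by omega
    have h2 : ((d : ℤ) - 1 - i).toNat < d := by omega
    rw [extendIndex, if_neg (by omega), dif_pos h2, extendTop, dif_pos h]
    congr 2
    refine Fin.ext ?_
    simp only [Fin.val_rev]
    omega
  · rw [extendIndex, if_pos (by omega), extendTop, dif_neg h]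

/-- The reversal i ↦ d - 1 - i moves the centre j to n - 1 and the negative indices beyond d.
Windows of radius at least d - j reach an index ≥ d of the original sequence, where its value is 0.
-/
theorem sumOfMins_eq_minSum {d j : ℕ} (hj : j < d) (x : Fin d → ℕ) :
    sumOfMins x j = minSum (d - j) (extendTop (x ∘ Fin.rev)) := by
  rw [sumOfMins, minSum, ← Finset.sum_subset (Finset.range_mono (show d - j ≤ d + 1 by omega))]
  · refine Finset.sum_congr rfl fun s hs => ?_
    rw [Finset.mem_range] at hs
    have h : Finset.Icc ((j : ℤ) - s) ((j : ℤ) + s) =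
        (Finset.Icc (d - j - 1 - s) (d - j - 1 + s)).image fun i : ℕ => (d : ℤ) - 1 - i := by
      ext z
      simp only [Finset.mem_Icc, Finset.mem_image]
      constructor
      · intro hz
        exact ⟨((d : ℤ) - 1 - z).toNat, by omega, by omega⟩
      · rintro ⟨i, hi, rfl⟩
        omega
    rw [h, Finset.inf_image]
    exact Finset.inf_congr rfl fun i _ => extendIndex_eq_extendTop x i
  · intro s hs hs'
    rw [Finset.mem_range] at hs hs'
    rw [← nonpos_iff_eq_zero]
    refine (Finset.inf_le (Finset.mem_Icc.2
      ⟨show (j : ℤ) - s ≤ (j : ℤ) + s by omega, le_rfl⟩)).trans ?_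
    rw [extendIndex, if_neg (by omega), dif_neg (by omega)]

end SumOfMins

/-! ### Subresultants under ring homomorphisms. -/

section BaseChange

variable {R S : Type*} [CommRing R] [CommRing S]

theorem map_principalSubresultant (f : R →+* S) (A B : R[X]) (dA dB j : ℕ) :
    f (principalSubresultant A B dA dB j) =
      principalSubresultant (A.map f) (B.map f) dA dB j := by
  rw [principalSubresultant, principalSubresultant, RingHom.map_det]
  congr 1
  ext r c
  simp only [RingHom.mapMatrix_apply, Matrix.map_apply, truncatedSylvester, Matrix.of_apply]
  refine Fin.addCases (fun c => ?_) (fun c => ?_) c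
  · simp only [Fin.addCases_left]
    rw [← coeff_map, Polynomial.map_mul, Polynomial.map_pow, map_X]
  · simp only [Fin.addCases_right]
    rw [← coeff_map, Polynomial.map_mul, Polynomial.map_pow, map_X]

theorem map_monicOfCoeffs (f : R →+* S) {d : ℕ} (a : Fin d → R) :
    (monicOfCoeffs a).map f = monicOfCoeffs (f ∘ a) := by
  simp [monicOfCoeffs, Polynomial.map_sum]

theorem associated_principalSubresultant_hankelDetOfCoeffs [Nontrivial R] {d j : ℕ} (hj : j ≤ d)
    (a b : Fin d → R) :
    Associated (principalSubresultant (monicOfCoeffs a) (monicOfCoeffs b) d d j)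
      (hankelDetOfCoeffs (d - j) (a, b - a)) := by
  have h : monicOfCoeffs b - monicOfCoeffs a = lowPoly (b - a) := by
    rw [monicOfCoeffs_eq_add_lowPoly, monicOfCoeffs_eq_add_lowPoly, add_sub_add_left_eq_sub]
    simp [lowPoly, sub_mul]
  have := associated_principalSubresultant_hankelDet (monic_monicOfCoeffs a)
    (natDegree_monicOfCoeffs a) (by rw [h]; exact degree_lowPoly_lt _) hj
  rwa [h] at this

end BaseChange

/-! ### Arithmetic of the quotients W / ϖ^N. -/

section Quotient

variable {W : Type*} [CommRing W]

theorem mk_pow_dvd_iff {ϖ : W} {N b : ℕ} (hb : b ≤ N) (x : W) :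
    Ideal.Quotient.mk (Ideal.span {ϖ} ^ N) ϖ ^ b ∣ Ideal.Quotient.mk (Ideal.span {ϖ} ^ N) x ↔
      ϖ ^ b ∣ x := by
  constructor
  · rintro ⟨y, hy⟩
    obtain ⟨y, rfl⟩ := Ideal.Quotient.mk_surjective y
    rw [← map_pow, ← map_mul, Ideal.Quotient.mk_eq_mk_iff_sub_mem, Ideal.span_singleton_pow,
      Ideal.mem_span_singleton] at hy
    have h1 := (pow_dvd_pow ϖ hb).trans hy
    exact (dvd_sub_left (dvd_mul_right _ _)).1 h1
  · intro h
    rw [← map_pow]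
    exact map_dvd _ h

variable [IsDomain W]

/-- For b ≤ N, divisibility by π^b is already visible in the domain W, where ϖ^a cancels. -/
theorem pow_sub_dvd_of_pow_dvd {ϖ : W} (hϖ : Irreducible ϖ) {N : ℕ} (a b : ℕ)
    (x : W ⧸ Ideal.span {ϖ} ^ N) (hb : b ≤ N)
    (h : Ideal.Quotient.mk (Ideal.span {ϖ} ^ N) ϖ ^ b ∣
      Ideal.Quotient.mk (Ideal.span {ϖ} ^ N) ϖ ^ a * x) :
    Ideal.Quotient.mk (Ideal.span {ϖ} ^ N) ϖ ^ (b - a) ∣ x := by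
  obtain ⟨y, rfl⟩ := Ideal.Quotient.mk_surjective x
  rw [← map_pow _ _ a, ← map_mul, mk_pow_dvd_iff hb] at h
  rw [mk_pow_dvd_iff (by omega)]
  rcases le_total b a with hab | hab
  · rw [Nat.sub_eq_zero_of_le hab, pow_zero]
    exact one_dvd _
  · rw [show b = a + (b - a) by omega, pow_add] at h
    exact (mul_dvd_mul_iff_left (pow_ne_zero a hϖ.ne_zero)).1 h

variable [IsDiscreteValuationRing W]

theorem isUnit_or_dvd_mk {ϖ : W} (hϖ : Irreducible ϖ) {I : Ideal W} (x : W ⧸ I) :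
    IsUnit x ∨ Ideal.Quotient.mk I ϖ ∣ x := by
  obtain ⟨y, rfl⟩ := Ideal.Quotient.mk_surjective x
  by_cases hy : IsUnit y
  · exact Or.inl (hy.map _)
  · refine Or.inr (map_dvd _ ?_)
    rwa [← Ideal.mem_span_singleton, ← hϖ.maximalIdeal_eq, IsLocalRing.mem_maximalIdeal]

/-- The multiples of π form the kernel of the surjection onto the residue field. -/
theorem proportion_mk_dvd {ϖ : W} (hϖ : Irreducible ϖ) {N : ℕ} (hN : N ≠ 0)
    [Finite (W ⧸ Ideal.span {ϖ} ^ N)] :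
    proportion (fun x : W ⧸ Ideal.span {ϖ} ^ N => Ideal.Quotient.mk _ ϖ ∣ x) =
      (Nat.card (IsLocalRing.ResidueField W) : ℝ)⁻¹ := by
  have hle : Ideal.span {ϖ} ^ N ≤ IsLocalRing.maximalIdeal W := by
    rw [hϖ.maximalIdeal_eq]
    exact Ideal.pow_le_self hN
  obtain ⟨f, hf⟩ : ∃ f : (W ⧸ Ideal.span {ϖ} ^ N) →+* IsLocalRing.ResidueField W,
      ∀ y, f (Ideal.Quotient.mk _ y) = IsLocalRing.residue W y :=
    ⟨Ideal.Quotient.lift _ (IsLocalRing.residue W) fun a ha =>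
      (IsLocalRing.residue_eq_zero_iff a).2 (hle ha), fun y => Ideal.Quotient.lift_mk _ _ _⟩
  have hsurj : Function.Surjective f := fun z => by
    obtain ⟨y, rfl⟩ := IsLocalRing.residue_surjective z
    exact ⟨_, hf y⟩
  have hker : {x : W ⧸ Ideal.span {ϖ} ^ N | Ideal.Quotient.mk _ ϖ ∣ x} =
      (f.toAddMonoidHom.ker : Set (W ⧸ Ideal.span {ϖ} ^ N)) := by
    ext x
    obtain ⟨y, rfl⟩ := Ideal.Quotient.mk_surjective x
    have h1 := mk_pow_dvd_iff (ϖ := ϖ) (N := N) (b := 1) (by omega) y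
    rw [pow_one, pow_one] at h1
    have h2 : Ideal.Quotient.mk (Ideal.span {ϖ} ^ N) y ∈ f.toAddMonoidHom.ker ↔
        f (Ideal.Quotient.mk _ y) = 0 := Iff.rfl
    rw [Set.mem_ofPred_eq, h1, SetLike.mem_coe, h2, hf, IsLocalRing.residue_eq_zero_iff,
      hϖ.maximalIdeal_eq, Ideal.mem_span_singleton]
  have hcard := AddSubgroup.card_mul_index f.toAddMonoidHom.ker
  rw [AddSubgroup.index_ker,
    AddMonoidHom.range_eq_top.2 (show Function.Surjective f.toAddMonoidHom from hsurj),
    AddSubgroup.card_top] at hcard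
  have hR : (Nat.card (W ⧸ Ideal.span {ϖ} ^ N) : ℝ) ≠ 0 := by exact_mod_cast Nat.card_pos.ne'
  rw [proportion, hker, ← Nat.card_coe_set_eq]
  have h3 := congrArg (Nat.cast : ℕ → ℝ) hcard
  rw [Nat.cast_mul] at h3
  rw [← h3] at hR ⊢
  have h4 := right_ne_zero_of_mul hR
  have h5 := left_ne_zero_of_mul hR
  rw [div_eq_iff (mul_ne_zero h5 h4)]
  have h6 : (Nat.card (f.toAddMonoidHom.ker : Set (W ⧸ Ideal.span {ϖ} ^ N)) : ℝ) =
    Nat.card f.toAddMonoidHom.ker := rfl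
  rw [h6]
  field_simp

end Quotient

/-! ### Haar measure reduces to the uniform law. -/

section Reduction

variable {W : Type*} [CommRing W]

/-- Coefficientwise reduction of a pair of vectors. -/
def reducePair (I : Ideal W) (d : ℕ) (ω : (Fin d → W) × (Fin d → W)) :
    (Fin d → W ⧸ I) × (Fin d → W ⧸ I) :=
  (Ideal.Quotient.mk I ∘ ω.1, Ideal.Quotient.mk I ∘ ω.2)

theorem reducePair_preimage_singleton (I : Ideal W) (d : ℕ)
    (y : (Fin d → W ⧸ I) × (Fin d → W ⧸ I)) :
    reducePair I d ⁻¹' {y} = (Set.univ.pi fun i => Ideal.Quotient.mk I ⁻¹' {y.1 i}) ×ˢ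
      (Set.univ.pi fun i => Ideal.Quotient.mk I ⁻¹' {y.2 i}) := by
  ext ω
  simp [reducePair, Prod.ext_iff, funext_iff]

variable [TopologicalSpace W]

theorem isTopologicalRing_of_isAdic {J : Ideal W} (hJ : IsAdic J) : IsTopologicalRing W := by
  have := J.adic_basis.toRing_subgroups_basis.toRingFilterBasis.isTopologicalRing
  rw [IsAdic] at hJ
  rw [hJ]
  exact this

theorem isOpen_preimage_mk_pow {J : Ideal W} (hJ : IsAdic J) (N : ℕ) (S : Set (W ⧸ J ^ N)) :
    IsOpen (Ideal.Quotient.mk (J ^ N) ⁻¹' S) := by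
  have := isTopologicalRing_of_isAdic hJ
  have hopen := (isAdic_iff.1 hJ).1 N
  rw [isOpen_iff_forall_mem_open]
  intro x hx
  refine ⟨(fun y => y - x) ⁻¹' ((J ^ N : Ideal W) : Set W), fun y hy => ?_,
    hopen.preimage (by fun_prop), by simp⟩
  have h : Ideal.Quotient.mk (J ^ N) y = Ideal.Quotient.mk (J ^ N) x :=
    (Ideal.Quotient.mk_eq_mk_iff_sub_mem _ _).2 hy
  rw [Set.mem_preimage, h]
  exact hx

variable [MeasurableSpace W] [BorelSpace W]

theorem measurableSet_preimage_mk_pow {J : Ideal W} (hJ : IsAdic J) (N : ℕ)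
    (S : Set (W ⧸ J ^ N)) : MeasurableSet (Ideal.Quotient.mk (J ^ N) ⁻¹' S) :=
  (isOpen_preimage_mk_pow hJ N S).measurableSet

/-- The residue classes are translates of one another and partition W. -/
theorem measureReal_preimage_mk_singleton {J : Ideal W} (hJ : IsAdic J) (μ : Measure W)
    [μ.IsAddHaarMeasure] [IsProbabilityMeasure μ] (N : ℕ) [Finite (W ⧸ J ^ N)] (r : W ⧸ J ^ N) :
    μ.real (Ideal.Quotient.mk (J ^ N) ⁻¹' {r}) = (Nat.card (W ⧸ J ^ N) : ℝ)⁻¹ := by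
  classical
  have := isTopologicalRing_of_isAdic hJ
  have := Fintype.ofFinite (W ⧸ J ^ N)
  have hconst : ∀ s, μ.real (Ideal.Quotient.mk (J ^ N) ⁻¹' {s}) =
      μ.real (Ideal.Quotient.mk (J ^ N) ⁻¹' {r}) := by
    intro s
    obtain ⟨g, hg⟩ := Ideal.Quotient.mk_surjective (r - s)
    have h := measure_preimage_add μ g (Ideal.Quotient.mk (J ^ N) ⁻¹' {r})
    rw [Measure.real, Measure.real, ← h]
    congr 2
    ext x
    simp only [Set.mem_preimage, Set.mem_singleton_iff, map_add, hg]
    constructor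
    · rintro rfl; ring
    · intro h; linear_combination h
  have hsum : ∑ s : W ⧸ J ^ N, μ.real (Ideal.Quotient.mk (J ^ N) ⁻¹' {s}) = 1 := by
    rw [← measureReal_biUnion_finset]
    · rw [← probReal_univ (μ := μ)]
      congr 1
      exact Set.eq_univ_of_forall fun x => by simp
    · intro s _ s' _ hss'
      exact Disjoint.preimage _ (Set.disjoint_singleton.2 hss')
    · exact fun s _ => measurableSet_preimage_mk_pow hJ N _
  simp only [hconst, Finset.sum_const, Finset.card_univ, nsmul_eq_mul] at hsum
  rw [Nat.card_eq_fintype_card]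
  exact eq_inv_of_mul_eq_one_right hsum

theorem measurableSet_reducePair_preimage {J : Ideal W} (hJ : IsAdic J) (N : ℕ)
    [Finite (W ⧸ J ^ N)] {d : ℕ} (T : Set ((Fin d → W ⧸ J ^ N) × (Fin d → W ⧸ J ^ N))) :
    MeasurableSet (reducePair (J ^ N) d ⁻¹' T) := by
  rw [← Set.biUnion_preimage_singleton]
  refine MeasurableSet.biUnion T.to_countable fun y _ => ?_
  rw [reducePair_preimage_singleton]
  exact (MeasurableSet.univ_pi fun i => measurableSet_preimage_mk_pow hJ N _).prod
    (MeasurableSet.univ_pi fun i => measurableSet_preimage_mk_pow hJ N _)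

theorem measureReal_reducePair_preimage {J : Ideal W} (hJ : IsAdic J) (μ : Measure W)
    [μ.IsAddHaarMeasure] [IsProbabilityMeasure μ] (N : ℕ) [Finite (W ⧸ J ^ N)] {d : ℕ}
    (p : (Fin d → W ⧸ J ^ N) × (Fin d → W ⧸ J ^ N) → Prop) :
    ((Measure.pi fun _ : Fin d => μ).prod (Measure.pi fun _ : Fin d => μ)).real
      {ω | p (reducePair (J ^ N) d ω)} = proportion p := by
  classical
  have := Fintype.ofFinite (W ⧸ J ^ N)
  have h : {ω | p (reducePair (J ^ N) d ω)} =
      ⋃ y ∈ Finset.univ.filter p, reducePair (J ^ N) d ⁻¹' {y} := by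
    ext ω
    simp
  have hpoint : ∀ y : (Fin d → W ⧸ J ^ N) × (Fin d → W ⧸ J ^ N),
      ((Measure.pi fun _ : Fin d => μ).prod (Measure.pi fun _ : Fin d => μ)).real
        (reducePair (J ^ N) d ⁻¹' {y}) =
      (Nat.card ((Fin d → W ⧸ J ^ N) × (Fin d → W ⧸ J ^ N)) : ℝ)⁻¹ := by
    intro y
    have hpi : ∀ c : Fin d → W ⧸ J ^ N, ((Measure.pi fun _ : Fin d => μ)
        (Set.univ.pi fun i => Ideal.Quotient.mk (J ^ N) ⁻¹' {c i})).toReal =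
        ((Nat.card (W ⧸ J ^ N) : ℝ)⁻¹) ^ d := by
      intro c
      rw [Measure.pi_pi, ENNReal.toReal_prod]
      have h1 : ∀ i, (μ (Ideal.Quotient.mk (J ^ N) ⁻¹' {c i})).toReal =
        (Nat.card (W ⧸ J ^ N) : ℝ)⁻¹ := fun i => measureReal_preimage_mk_singleton hJ μ N (c i)
      simp [h1]
    rw [reducePair_preimage_singleton, Measure.real, Measure.prod_prod, ENNReal.toReal_mul,
      hpi, hpi]
    simp
  rw [h, measureReal_biUnion_finset]
  · simp only [hpoint, Finset.sum_const, nsmul_eq_mul]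
    rw [proportion, div_eq_mul_inv, Set.ncard_eq_toFinset_card']
    congr 3
    ext y
    simp
  · intro y _ y' _ hyy'
    exact Disjoint.preimage _ (Set.disjoint_singleton.2 hyy')
  · exact fun y _ => measurableSet_reducePair_preimage hJ N _

end Reduction

/-! ### Valuations as divisibility in the quotients. -/

section Valuation

variable {W : Type*} [CommRing W] [IsDomain W] [IsDiscreteValuationRing W]

theorem natCast_le_addVal_iff {ϖ : W} (hϖ : Irreducible ϖ) (w : ℕ) (x : W) :
    (w : ℕ∞) ≤ IsDiscreteValuationRing.addVal W x ↔ ϖ ^ w ∣ x := by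
  rw [← IsDiscreteValuationRing.addVal_le_iff_dvd, AddValuation.map_pow,
    IsDiscreteValuationRing.addVal_uniformizer hϖ]
  simp

theorem natCast_le_valPrincipalSubresultant_iff {ϖ : W} (hϖ : Irreducible ϖ) {d j N : ℕ}
    (hj : j ≤ d) (hN : N ≠ 0) (ω : (Fin d → W) × (Fin d → W)) :
    (N : ℕ∞) ≤ valPrincipalSubresultant d j ω ↔
      Ideal.Quotient.mk (Ideal.span {ϖ} ^ N) ϖ ^ N ∣ hankelDetOfCoeffs (d - j)
        ((reducePair (Ideal.span {ϖ} ^ N) d ω).1,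
          (reducePair (Ideal.span {ϖ} ^ N) d ω).2 - (reducePair (Ideal.span {ϖ} ^ N) d ω).1) := by
  have : Nontrivial (W ⧸ Ideal.span {ϖ} ^ N) := by
    refine Ideal.Quotient.nontrivial_iff.2 fun h => hϖ.not_isUnit ?_
    rw [← Ideal.span_singleton_eq_top, eq_top_iff, ← h]
    exact Ideal.pow_le_self hN
  rw [valPrincipalSubresultant, natCast_le_addVal_iff hϖ, ← mk_pow_dvd_iff le_rfl,
    map_principalSubresultant, map_monicOfCoeffs, map_monicOfCoeffs]
  exact (associated_principalSubresultant_hankelDetOfCoeffs hj _ _).dvd_iff_dvd_right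

theorem proportion_sub {R : Type*} [CommRing R] {d : ℕ} (p : (Fin d → R) × (Fin d → R) → Prop) :
    proportion (fun y : (Fin d → R) × (Fin d → R) => p (y.1, y.2 - y.1)) = proportion p := by
  let F : (Fin d → R) × (Fin d → R) ≃ (Fin d → R) × (Fin d → R) :=
    { toFun := fun y => (y.1, y.2 - y.1)
      invFun := fun y => (y.1, y.2 + y.1)
      left_inv := fun y => by simp
      right_inv := fun y => by simp }
  have h : {y | p y} = F '' {y | p (F y)} := by
    ext y
    rw [F.image_eq_preimage_symm]
    simp
  rw [proportion, proportion, h, Set.ncard_image_of_injective _ F.injective]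
  rfl

end Valuation

/-! ### Measures on the extended natural numbers. -/

section ENat

instance ENat.borelSpace : BorelSpace ℕ∞ := ⟨by rw [borel_eq_top_of_countable]; rfl⟩

theorem Set.Ici_top_eq_iInter_natCast : (Set.Ici ⊤ : Set ℕ∞) = ⋂ n : ℕ, Set.Ici (n : ℕ∞) := by
  ext x
  simp only [Set.mem_Ici, Set.mem_iInter]
  refine ⟨fun h n => le_top.trans h, fun h => ?_⟩
  exact (ENat.eq_top_iff_forall_ge.2 h).ge

theorem measurable_of_Ici_natCast {α : Type*} [MeasurableSpace α] {f : α → ℕ∞}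
    (h : ∀ n : ℕ, MeasurableSet (f ⁻¹' Set.Ici (n : ℕ∞))) : Measurable f := by
  refine measurable_of_Ici fun x => ?_
  induction x using ENat.recTopCoe with
  | top =>
    rw [Set.Ici_top_eq_iInter_natCast, Set.preimage_iInter]
    exact MeasurableSet.iInter h
  | coe n => exact h n

/-- The half-line at ⊤ is the decreasing intersection of the finite ones, so continuity from above
recovers its mass. -/
theorem measure_ext_of_Ici_natCast {μ ν : Measure ℕ∞} [IsFiniteMeasure μ] [IsFiniteMeasure ν]
    (h : ∀ n : ℕ, μ (Set.Ici (n : ℕ∞)) = ν (Set.Ici (n : ℕ∞))) : μ = ν := by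
  refine Measure.ext_of_Ici _ _ fun x => ?_
  induction x using ENat.recTopCoe with
  | top =>
    have hanti : Antitone fun n : ℕ => Set.Ici (n : ℕ∞) := fun m n hmn =>
      Set.Ici_subset_Ici.2 (by exact_mod_cast hmn)
    have h1 := tendsto_measure_iInter_atTop (μ := μ)
      (fun n : ℕ => measurableSet_Ici.nullMeasurableSet) hanti ⟨0, measure_ne_top _ _⟩
    have h2 := tendsto_measure_iInter_atTop (μ := ν)
      (fun n : ℕ => measurableSet_Ici.nullMeasurableSet) hanti ⟨0, measure_ne_top _ _⟩
    rw [← Set.Ici_top_eq_iInter_natCast] at h1 h2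
    refine tendsto_nhds_unique h1 (h2.congr fun n => ?_)
    exact (h n).symm
  | coe n => exact h n

end ENat

/-! ### The law of the valuations of the principal subresultants. -/

theorem theorem3p3
    {W : Type*} [CommRing W] [IsDomain W] [IsDiscreteValuationRing W]
    [IsAdicComplete (IsLocalRing.maximalIdeal W) W]
    [Finite (IsLocalRing.ResidueField W)]
    [TopologicalSpace W] (hW : IsAdic (IsLocalRing.maximalIdeal W))
    [MeasurableSpace W] [BorelSpace W]
    (μ : Measure W) [μ.IsAddHaarMeasure] [IsProbabilityMeasure μ]
    (d j : ℕ) (hj : j < d)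
    (p : unitInterval) (hp : (p : ℝ) = 1 - (Nat.card (IsLocalRing.ResidueField W) : ℝ)⁻¹)
    {Ω : Type*} [MeasurableSpace Ω] (P : Measure Ω) [IsProbabilityMeasure P]
    (X : Fin d → Ω → ℕ) (hXindep : iIndepFun X P)
    (hXlaw : ∀ i, HasLaw (X i) (geometricMeasure p) P) :
    IdentDistrib (valPrincipalSubresultant (W := W) d j)
      (fun ω => sumOfMins (fun i => X i ω) j)
      ((Measure.pi fun _ : Fin d => μ).prod (Measure.pi fun _ : Fin d => μ)) P := by
  obtain ⟨ϖ, hϖ⟩ := IsDiscreteValuationRing.exists_irreducible W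
  have hmax := hϖ.maximalIdeal_eq
  have hfin : ∀ N, Finite (W ⧸ Ideal.span {ϖ} ^ N) := by
    have h0 : Finite (W ⧸ Ideal.span {ϖ}) := by
      rw [← hmax]; exact ‹Finite (IsLocalRing.ResidueField W)›
    exact fun N => Ideal.finite_quotient_pow ⟨{ϖ}, by simp⟩ N
  rw [hmax] at hW
  have hp0 : p ≠ 0 := by
    rintro rfl
    have h1 : 1 < Nat.card (IsLocalRing.ResidueField W) := Finite.one_lt_card
    have h2 : (Nat.card (IsLocalRing.ResidueField W) : ℝ)⁻¹ < 1 :=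
      inv_lt_one_of_one_lt₀ (by exact_mod_cast h1)
    rw [Set.Icc.coe_zero] at hp
    linarith
  -- N ≤ V_j is a condition on residues modulo ϖ^N; this gives both its measurability and its
  -- probability. N = 0, where the quotient is trivial, is treated apart.
  have hset : ∀ N : ℕ, N ≠ 0 → valPrincipalSubresultant (W := W) d j ⁻¹' Set.Ici (N : ℕ∞) =
      reducePair (Ideal.span {ϖ} ^ N) d ⁻¹' {y |
        Ideal.Quotient.mk (Ideal.span {ϖ} ^ N) ϖ ^ N ∣
          hankelDetOfCoeffs (d - j) (y.1, y.2 - y.1)} := fun N hN => by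
    ext ω
    exact natCast_le_valPrincipalSubresultant_iff hϖ hj.le hN ω
  have hVmeas : Measurable (valPrincipalSubresultant (W := W) d j) := by
    refine measurable_of_Ici_natCast fun N => ?_
    rcases eq_or_ne N 0 with rfl | hN
    · simp
    rw [hset N hN]
    exact measurableSet_reducePair_preimage hW N _
  have hXrev : iIndepFun (fun i => X (Fin.rev i)) P := hXindep.precomp Fin.rev_injective
  have hXae : ∀ i, AEMeasurable (X (Fin.rev i)) P := fun i => (hXlaw _).aemeasurable
  have hpi : P.map (fun ω i => X (Fin.rev i) ω) =
      Measure.pi fun _ : Fin d => geometricMeasure p := by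
    rw [(iIndepFun_iff_map_fun_eq_pi_map hXae).1 hXrev]
    congr 1
    ext1 i
    exact (hXlaw _).map_eq
  have hY : (fun ω => sumOfMins (fun i => X i ω) j) =
      (fun x => minSum (d - j) (extendTop x)) ∘ fun ω i => X (Fin.rev i) ω := by
    ext1 ω
    exact sumOfMins_eq_minSum hj _
  have hXpi : AEMeasurable (fun ω i => X (Fin.rev i) ω) P := aemeasurable_pi_lambda _ hXae
  have hg : Measurable fun x : Fin d → ℕ => minSum (d - j) (extendTop x) := Measurable.of_discrete
  have hYae : AEMeasurable (fun ω => sumOfMins (fun i => X i ω) j) P := by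
    rw [hY]
    exact hg.comp_aemeasurable hXpi
  refine ⟨hVmeas.aemeasurable, hYae, ?_⟩
  have := Measure.isProbabilityMeasure_map hVmeas.aemeasurable
    (μ := (Measure.pi fun _ : Fin d => μ).prod (Measure.pi fun _ : Fin d => μ))
  have := Measure.isProbabilityMeasure_map hYae (μ := P)
  refine measure_ext_of_Ici_natCast fun N => ?_
  rcases eq_or_ne N 0 with rfl | hN
  · have : Set.Ici ((0 : ℕ) : ℕ∞) = Set.univ := Set.eq_univ_of_forall fun x => by simp
    rw [this, measure_univ, measure_univ]
  have hnontriv : Nontrivial (W ⧸ Ideal.span {ϖ} ^ N) := by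
    refine Ideal.Quotient.nontrivial_iff.2 fun h => hϖ.not_isUnit ?_
    rw [← Ideal.span_singleton_eq_top, eq_top_iff, ← h]
    exact Ideal.pow_le_self hN
  have hnil : IsNilpotent (Ideal.Quotient.mk (Ideal.span {ϖ} ^ N) ϖ) :=
    ⟨N, by
      rw [← map_pow, Ideal.Quotient.eq_zero_iff_mem]
      exact Ideal.pow_mem_pow (Ideal.mem_span_singleton_self ϖ) N⟩
  rw [← (ENNReal.toReal_eq_toReal_iff' (measure_ne_top _ _) (measure_ne_top _ _)),
    Measure.map_apply hVmeas measurableSet_Ici, hset N hN, hY,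
    ← AEMeasurable.map_map_of_aemeasurable hg.aemeasurable hXpi, hpi,
    Measure.map_apply hg measurableSet_Ici]
  refine (measureReal_reducePair_preimage hW μ N (fun y =>
    Ideal.Quotient.mk (Ideal.span {ϖ} ^ N) ϖ ^ N ∣
      hankelDetOfCoeffs (d - j) (y.1, y.2 - y.1))).trans ?_
  rw [proportion_sub (fun y => Ideal.Quotient.mk (Ideal.span {ϖ} ^ N) ϖ ^ N ∣
      hankelDetOfCoeffs (d - j) y)]
  -- The ring is truncated at level N, exactly enough for the exponent w = N.
  exact hankelProb_eq_minSumProb (isUnit_or_dvd_mk hϖ) hnil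
    (fun a b x hb h => pow_sub_dvd_of_pow_dvd hϖ a b x hb h) hp0
    (by rw [hp, proportion_mk_dvd hϖ hN]) (by omega) le_rfl
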